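/- A transducer is a deterministic sequential transducer $T=(\{1,\dots,n\},1,\Delta)$ with $n\ge 1$ states, start state $1$ and transition function $\Delta:\{1,\dots,n\}\times\{0,1\}\to\{1,\dots,n\}\times\{0,1\}^*$; all its states are final, and two transducers are the same if they have the same transition function. It computes a function $T:\{0,1\}^*\to\{0,1\}^*$ by concatenating the outputs of the transitions used on the input. An encoding of transducers is a pair $S=(D_S,f_S)$, where $D_S\subseteq\{0,1\}^*$ and $f_S:D_S\to\{\text{all transducers}\}$, $\sigma\mapsto T^S_\sigma$, is a bijection. It is a polynomial-time encoding if $D_S\in\mathrm{P}$ and, given $\sigma\in D_S$, the list of transitions of $T^S_\sigma$ (with state names written in binary) can be computed in time polynomial in $|\sigma|$. For $x\in\{0,1\}^*$ let $$C_S(x)=\min\{|\sigma|+|p| : \sigma\in D_S,\ p\in\{0,1\}^*,\ T^S_\sigma(p)=x\},$$ and for $m\ge 0$ let $L^S_{\le m}$ be the set of all $x\in\{0,1\}^*$ for which there are $\sigma\in D_S$ and $p\in\{0,1\}^*$ such that $T^S_\sigma(p)=x$, $|\sigma|+|p|=C_S(x)$ and $T^S_\sigma$ has at most $m$ states (so $L^S_{\le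 0}=\emptyset$). There exists a polynomial-time encoding $S_1'$ such that $L^{S_1'}_{\le n-1}\subsetneq L^{S_1'}_{\le n}$ for every $n\ge 1$. -/

import Mathlib

namespace FSC

/-- A (left) sequential transducer with input and output alphabet `{0,1}` (a deterministic
generalised sequential machine, all states final). It is identified with its transition function;
the states are `1, …, numStates`, state `j` being the element `j - 1` of `Fin numStates`, and state
`1` is the start state. In particular there is at least one state. -/
structure Transducer where
  numStates : ℕ
  pos : 0 < numStates
  Δ : Fin numStates → Bool → Fin numStates × List Bool

namespace Transducer

/-- The start state, named `1`. -/
def start (T : Transducer) : Fin T.numStates := ⟨0, T.pos⟩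

/-- The output produced on an input word when starting in state `q`. -/
def runFrom (T : Transducer) : Fin T.numStates → List Bool → List Bool
  | _, [] => []
  | q, a :: x => (T.Δ q a).2 ++ runFrom T (T.Δ q a).1 x

/-- The function `{0,1}* → {0,1}*` computed by the transducer. -/
def run (T : Transducer) (p : List Bool) : List Bool := T.runFrom T.start p

/-- The name of a state, `bin(j)` for state `j ≥ 1`, most significant digit first, as a word over
`{0, 1, #}`. The letters `0, 1` are `some false, some true`, and `none` is the separator `#`. -/
def stateName {n : ℕ} (q : Fin n) : List (Option Bool) :=
  ((Nat.bits (q.val + 1)).reverse).map some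

/-- The transition `Δ(q, i) = (p, w)`, written `bin(q)#i#bin(p)#w#`. -/
def transition (T : Transducer) (q : Fin T.numStates) (i : Bool) : List (Option Bool) :=
  stateName q ++ [none, some i, none] ++ stateName (T.Δ q i).1 ++ [none] ++
    (T.Δ q i).2.map some ++ [none]

/-- The list of all transitions of the transducer, in the order
`(1,0), (1,1), (2,0), (2,1), …, (n,0), (n,1)`. -/
def transitionList (T : Transducer) : List (Option Bool) :=
  (List.finRange T.numStates).flatMap fun q => T.transition q false ++ T.transition q true

end Transducer

/-- A (bijective) encoding of all transducers by the words of a set `dom ⊆ {0,1}*`. -/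
structure Encoding where
  dom : Set (List Bool)
  decode : dom → Transducer
  bijective : Function.Bijective decode

namespace Encoding

open Classical in
/-- A polynomial-time (computable) encoding: the set of codes is decidable in polynomial time, and
some polynomial-time machine, given a code, outputs the list of transitions of the encoded
transducer, with state names in binary. Machines are Mathlib's multi-stack Turing machines. -/
structure IsPolyTime (S : Encoding) : Prop where
  mem_dom : Nonempty (Turing.TM2ComputableInPolyTime (fun w : List Bool => w)
    Computability.encodeBool (fun w : List Bool => decide (w ∈ S.dom)))
  decode : Nonempty (Turing.TM2ComputableInPolyTime (fun c : S.dom => (c : List Bool))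
    Transducer.transitionList S.decode)

/-- The finite-state complexity `C_S(x)`: the least size `|σ| + |p|` of a description of `x`.
The infimum is over a nonempty set, as the identity transducer has a code. -/
noncomputable def complexity (S : Encoding) (x : List Bool) : ℕ :=
  sInf {k | ∃ (c : S.dom) (p : List Bool), (S.decode c).run p = x ∧
    (c : List Bool).length + p.length = k}

/-- The language `L^S_{≤ m}` of all words with a minimal description by a transducer with at most
`m` states. -/
def level (S : Encoding) (m : ℕ) : Set (List Bool) :=
  {x | ∃ (c : S.dom) (p : List Bool), (S.decode c).run p = x ∧
    (c : List Bool).length + p.length = S.complexity x ∧ (S.decode c).numStates ≤ m}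

/-- The convention `L^S_{≤ 0} = ∅` is automatic, as every transducer has a state. -/
theorem level_zero (S : Encoding) : S.level 0 = ∅ := by
  refine Set.eq_empty_of_forall_notMem ?_
  rintro x ⟨c, p, -, -, h⟩
  exact absurd (S.decode c).pos (by omega)

end Encoding

end FSC

/-! The encoding is built so that the word `10ᵐ` with `m = 2n²` is cheap for transducers with
exactly `n` states. The code of a transducer has two marked blocks per state, which cost 4 bits per
state, and 2 bits for each letter of a transition code. A transition code starts with a number of
zeros; division by `n` gives the target state as remainder and the length of the final run of zeros
of the output as quotient. If the output contains a `1`, that quotient is reflected in `[0, 2n²]`.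
So the output `10ᵐ` with target `1` has a code of one letter, and `10ᵐ` has a description of size
`4n + 3` (`complexity_oneLongRun_le`).

Every other number of states is worse (`lt_length_of_run_eq`). With more than `n` states the markers
alone take `4n + 4` bits. With `k < n` states the reflection lengthens the output by at most `2k²`
per `1` written, and `10ᵐ` has a single `1`. The other zeros, more than `2(n² - k²)` letters with
the `1`, must come from the product of the total length of the transition codes and the input
length. By the inequality of the means this product is too expensive. Hence all minimal descriptions
of `10ᵐ` have exactly `n` states, and the word lies in level `n` but not in level `n - 1`.

Division with remainder and reflection are bijections, so every word is a valid transition code and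
the set of codes is a regular language. A finite automaton decides it. The transitions are computed
in cubic time by a program with unary counters, which is compiled to a multi-stack machine. -/

namespace FSC

open Turing

/-! ### Structured stack programs and their compilation to multi-stack machines. -/

section StackPrograms

variable {K : Type} {Γ : K → Type} {σ : Type}

/-- Structured programs over a family of stacks, with a register of type `σ`. -/
inductive Prog (Γ : K → Type) (σ : Type) : Type
  | skip : Prog Γ σ
  | push (k : K) (f : σ → Γ k) : Prog Γ σ
  | load (f : σ → σ) : Prog Γ σ
  | seq (p q : Prog Γ σ) : Prog Γ σ
  | ite (c : σ → Bool) (p q : Prog Γ σ) : Prog Γ σ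
  /-- Pop the stack `k`, update the register, and branch on the popped symbol. -/
  | popIte (k : K) (f : σ → Option (Γ k) → σ) (c : σ → Option (Γ k) → Bool)
      (p q : Prog Γ σ) : Prog Γ σ
  /-- Pop the stack `k`, update the register, and run the body and repeat if the condition on the
  popped symbol holds. -/
  | loop (k : K) (f : σ → Option (Γ k) → σ) (c : σ → Option (Γ k) → Bool)
      (p : Prog Γ σ) : Prog Γ σ

namespace Prog

/-- The control points of a program. -/
def Label : Prog Γ σ → Type
  | skip => Unit
  | push _ _ => Unit
  | load _ => Unit
  | seq p q => Label p ⊕ Label q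
  | ite _ p q => Option (Label p ⊕ Label q)
  | popIte _ _ _ p q => Option (Label p ⊕ Label q)
  | loop _ _ _ p => Option (Label p)

/-- The control point at which a program starts. -/
def entry : (p : Prog Γ σ) → Label p
  | skip => ()
  | push _ _ => ()
  | load _ => ()
  | seq p _ => Sum.inl (entry p)
  | ite _ _ _ => none
  | popIte _ _ _ _ _ => none
  | loop _ _ _ _ => none

/-- Programs have finitely many control points. -/
instance fintypeLabel : (p : Prog Γ σ) → Fintype (Label p)
  | skip => inferInstanceAs (Fintype Unit)
  | push _ _ => inferInstanceAs (Fintype Unit)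
  | load _ => inferInstanceAs (Fintype Unit)
  | seq p q =>
    letI := fintypeLabel p
    letI := fintypeLabel q
    inferInstanceAs (Fintype (Label p ⊕ Label q))
  | ite _ p q =>
    letI := fintypeLabel p
    letI := fintypeLabel q
    inferInstanceAs (Fintype (Option (Label p ⊕ Label q)))
  | popIte _ _ _ p q =>
    letI := fintypeLabel p
    letI := fintypeLabel q
    inferInstanceAs (Fintype (Option (Label p ⊕ Label q)))
  | loop _ _ _ p =>
    letI := fintypeLabel p
    inferInstanceAs (Fintype (Option (Label p)))

/-- The statements of a multi-stack machine at the control points of a program. The Boolean next to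
the register remembers the outcome of the last test. -/
def compile {Λ : Type} : (p : Prog Γ σ) → (Label p → Λ) → Λ → Label p →
    TM2.Stmt Γ Λ (σ × Bool)
  | skip, _, e => fun _ => .goto fun _ => e
  | push k f, _, e => fun _ => .push k (fun v => f v.1) (.goto fun _ => e)
  | load f, _, e => fun _ => .load (fun v => (f v.1, v.2)) (.goto fun _ => e)
  | seq p q, emb, e => fun l => match l with
    | Sum.inl l => compile p (fun l => emb (Sum.inl l)) (emb (Sum.inr (entry q))) l
    | Sum.inr l => compile q (fun l => emb (Sum.inr l)) e l
  | ite c p q, emb, e => fun l => match l with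
    | none => .branch (fun v => c v.1) (.goto fun _ => emb (some (Sum.inl (entry p))))
        (.goto fun _ => emb (some (Sum.inr (entry q))))
    | some (Sum.inl l) => compile p (fun l => emb (some (Sum.inl l))) e l
    | some (Sum.inr l) => compile q (fun l => emb (some (Sum.inr l))) e l
  | popIte k f c p q, emb, e => fun l => match l with
    | none => .pop k (fun v o => (f v.1 o, c v.1 o)) <|
        .branch (fun v => v.2) (.goto fun _ => emb (some (Sum.inl (entry p))))
        (.goto fun _ => emb (some (Sum.inr (entry q))))
    | some (Sum.inl l) => compile p (fun l => emb (some (Sum.inl l))) e l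
    | some (Sum.inr l) => compile q (fun l => emb (some (Sum.inr l))) e l
  | loop k f c p, emb, e => fun l => match l with
    | none => .pop k (fun v o => (f v.1 o, c v.1 o)) <|
        .branch (fun v => v.2) (.goto fun _ => emb (some (entry p))) (.goto fun _ => e)
    | some l => compile p (fun l => emb (some l)) (emb none) l

variable [DecidableEq K]

/-- `Run p v S t v' S'`: started with register `v` and stacks `S`, the program `p` ends with `v'`
and `S'` after at most `t` steps. -/
inductive Run : Prog Γ σ → σ → (∀ k, List (Γ k)) → ℕ → σ → (∀ k, List (Γ k)) → Prop
  | skip (v S) : Run skip v S 1 v S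
  | push (k f v S) : Run (push k f) v S 1 v (Function.update S k (f v :: S k))
  | load (f v S) : Run (load f) v S 1 (f v) S
  | seq {p q v S t v' S' t' v'' S''} : Run p v S t v' S' → Run q v' S' t' v'' S'' →
      Run (seq p q) v S (t + t') v'' S''
  | ite_true {c p q v S t v' S'} : c v = true → Run p v S t v' S' →
      Run (ite c p q) v S (t + 1) v' S'
  | ite_false {c p q v S t v' S'} : c v = false → Run q v S t v' S' →
      Run (ite c p q) v S (t + 1) v' S'
  | popIte_true {k f c p q v S t v' S'} : c v (S k).head? = true →
      Run p (f v (S k).head?) (Function.update S k (S k).tail) t v' S' →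
      Run (popIte k f c p q) v S (t + 1) v' S'
  | popIte_false {k f c p q v S t v' S'} : c v (S k).head? = false →
      Run q (f v (S k).head?) (Function.update S k (S k).tail) t v' S' →
      Run (popIte k f c p q) v S (t + 1) v' S'
  | loop_true {k f c p v S t v' S' t' v'' S''} : c v (S k).head? = true →
      Run p (f v (S k).head?) (Function.update S k (S k).tail) t v' S' →
      Run (loop k f c p) v' S' t' v'' S'' →
      Run (loop k f c p) v S (t + 1 + t') v'' S''
  | loop_false {k f c p v S} : c v (S k).head? = false →
      Run (loop k f c p) v S 1 (f v (S k).head?) (Function.update S k (S k).tail)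
  | mono {p v S t v' S' t'} : Run p v S t v' S' → t ≤ t' → Run p v S t' v' S'

/-- Reachability in at most `t` steps. -/
def ReachIn {Λ σ' : Type} (M : Λ → TM2.Stmt Γ Λ σ') (t : ℕ) (c c' : TM2.Cfg Γ Λ σ') : Prop :=
  ∃ n ≤ t, (flip bind (TM2.step M))^[n] (some c) = some c'

theorem ReachIn.trans {Λ σ' : Type} {M : Λ → TM2.Stmt Γ Λ σ'} {t t' : ℕ}
    {a b c : TM2.Cfg Γ Λ σ'} (h : ReachIn M t a b) (h' : ReachIn M t' b c) :
    ReachIn M (t + t') a c := by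
  obtain ⟨n, hn, e⟩ := h
  obtain ⟨m, hm, e'⟩ := h'
  refine ⟨m + n, by omega, ?_⟩
  rw [Function.iterate_add_apply, e, e']

theorem ReachIn.single {Λ σ' : Type} {M : Λ → TM2.Stmt Γ Λ σ'} {l : Λ} {v : σ'}
    {S : ∀ k, List (Γ k)} {c : TM2.Cfg Γ Λ σ'} (h : TM2.stepAux (M l) v S = c) :
    ReachIn M 1 ⟨some l, v, S⟩ c :=
  ⟨1, le_rfl, by simp [flip, h]⟩

theorem ReachIn.mono {Λ σ' : Type} {M : Λ → TM2.Stmt Γ Λ σ'} {t t' : ℕ} {a b : TM2.Cfg Γ Λ σ'}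
    (h : ReachIn M t a b) (ht : t ≤ t') : ReachIn M t' a b := by
  obtain ⟨n, hn, e⟩ := h
  exact ⟨n, hn.trans ht, e⟩

/-- A machine containing the compiled program simulates the runs of the program. -/
theorem Run.reachIn {Λ : Type} {M : Λ → TM2.Stmt Γ Λ (σ × Bool)} {p : Prog Γ σ} {v S t v' S'}
    (h : Run p v S t v' S') : ∀ (emb : Label p → Λ) (e : Λ)
    (_ : ∀ l, M (emb l) = compile p emb e l) (b : Bool),
    ∃ b', ReachIn M t ⟨some (emb (entry p)), (v, b), S⟩ ⟨some e, (v', b'), S'⟩ := by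
  induction h with
  | skip v S => exact fun emb e hM b => ⟨b, .single (by rw [hM]; simp [compile])⟩
  | push k f v S => exact fun emb e hM b => ⟨b, .single (by rw [hM]; simp [compile])⟩
  | load f v S => exact fun emb e hM b => ⟨b, .single (by rw [hM]; simp [compile])⟩
  | @seq p q _ _ _ _ _ _ _ _ _ _ ih₁ ih₂ =>
    intro emb e hM b
    obtain ⟨b₁, h₁⟩ := ih₁ (fun l => emb (Sum.inl l)) (emb (Sum.inr (entry q)))
      (fun l => hM _) b
    obtain ⟨b₂, h₂⟩ := ih₂ (fun l => emb (Sum.inr l)) e (fun l => hM _) b₁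
    exact ⟨b₂, h₁.trans h₂⟩
  | @ite_true c p q v S _ _ _ hc _ ih =>
    intro emb e hM b
    obtain ⟨b₁, h₁⟩ := ih (fun l => emb (some (Sum.inl l))) e
      (fun l => hM _) b
    refine ⟨b₁, ((ReachIn.single ?_).trans h₁).mono (Nat.add_comm _ _).le⟩
    rw [hM]; simp [compile, entry, hc]
  | @ite_false c p q v S _ _ _ hc _ ih =>
    intro emb e hM b
    obtain ⟨b₁, h₁⟩ := ih (fun l => emb (some (Sum.inr l))) e
      (fun l => hM _) b
    refine ⟨b₁, ((ReachIn.single ?_).trans h₁).mono (Nat.add_comm _ _).le⟩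
    rw [hM]; simp [compile, entry, hc]
  | popIte_true hc _ ih =>
    intro emb e hM b
    -- The pop overwrites the flag `b` with the outcome of the test, so the body starts with that
    -- value.
    obtain ⟨b₁, h₁⟩ := ih (fun l => emb (some (Sum.inl l))) e
      (fun l => hM _) true
    refine ⟨b₁, ((ReachIn.single ?_).trans h₁).mono (Nat.add_comm _ _).le⟩
    rw [hM]; simp [compile, entry, hc]
  | popIte_false hc _ ih =>
    intro emb e hM b
    obtain ⟨b₁, h₁⟩ := ih (fun l => emb (some (Sum.inr l))) e
      (fun l => hM _) false
    refine ⟨b₁, ((ReachIn.single ?_).trans h₁).mono (Nat.add_comm _ _).le⟩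
    rw [hM]; simp [compile, entry, hc]
  | loop_true hc _ _ ih₁ ih₂ =>
    intro emb e hM b
    obtain ⟨b₁, h₁⟩ := ih₁ (fun l => emb (some l)) (emb none)
      (fun l => hM _) true
    obtain ⟨b₂, h₂⟩ := ih₂ emb e hM b₁
    refine ⟨b₂, (((ReachIn.single ?_).trans h₁).trans h₂).mono (by omega)⟩
    rw [hM]; simp [compile, entry, hc]
  | loop_false hc =>
    intro emb e hM b
    refine ⟨false, .single ?_⟩
    rw [hM]; simp [compile, entry, hc]
  | mono _ ht ih =>
    intro emb e hM b
    obtain ⟨b₁, h₁⟩ := ih emb e hM b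
    exact ⟨b₁, h₁.mono ht⟩

/-- The machine which runs a program, resets the register and halts. -/
def machine [Fintype K] [Fintype σ] (p : Prog Γ σ) (k₀ k₁ : K) [Fintype (Γ k₀)] (v₀ : σ) :
    FinTM2 where
  K := K
  k₀ := k₀
  k₁ := k₁
  Γ := Γ
  Λ := Option (Label p)
  main := some (entry p)
  σ := σ × Bool
  initialState := (v₀, false)
  m l := match l with
    | none => .load (fun _ => (v₀, false)) .halt
    | some l => compile p some none l

/-- The stacks that are empty with the exception of `k`, which holds `l`. -/
def onlyStack (k : K) (l : List (Γ k)) : ∀ k, List (Γ k) := Function.update (fun _ => []) k l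

/-- The left side is the form in which `initList` and `haltList` describe their stacks. The equation
`hl` absorbs the mapping of the word along the identity equivalence of alphabets. -/
theorem onlyStack_eq (k₀ : K) (l l' : List (Γ k₀)) (hl : l = l') :
    (fun k => dite (k = k₀) (fun h => (congrArg (fun k => List (Γ k)) h).mpr l) fun _ => []) =
      onlyStack k₀ l' := by
  subst hl
  funext k
  by_cases hk : k = k₀
  · subst hk; simp [onlyStack]
  · simp [onlyStack, hk]

/-- A program computing a function within a polynomial number of steps gives a polynomial-time
machine. -/
noncomputable def polyTime [Fintype K] [Fintype σ] (p : Prog Γ σ) {k₀ k₁ : K}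
    [Fintype (Γ k₀)] (v₀ : σ) {α β : Type} (ea : α → List (Γ k₀)) (eb : β → List (Γ k₁)) (f : α → β)
    (time : Polynomial ℕ)
    (h : ∀ a, ∃ v, Run p v₀ (onlyStack k₀ (ea a)) (time.eval (ea a).length) v
      (onlyStack k₁ (eb (f a)))) :
    TM2ComputableInPolyTime ea eb f where
  tm := machine p k₀ k₁ v₀
  inputAlphabet := Equiv.refl _
  outputAlphabet := Equiv.refl _
  -- The extra step is the statement at the label `none`: `haltList` prescribes the initial
  -- register.
  time := time + 1
  outputsFun a := by
    apply Classical.choice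
    obtain ⟨v, hv⟩ := h a
    obtain ⟨b, hb⟩ := hv.reachIn (M := (machine p k₀ k₁ v₀).m) some none (fun _ => rfl) false
    have hend : ReachIn (machine p k₀ k₁ v₀).m 1
        ⟨some none, (v, b), onlyStack k₁ (eb (f a))⟩
        ⟨none, (v₀, false), onlyStack k₁ (eb (f a))⟩ := .single rfl
    obtain ⟨n, hn, e⟩ := hb.trans hend
    refine ⟨⟨⟨n, ?_⟩, by simpa using hn⟩⟩
    have h₁ : initList (machine p k₀ k₁ v₀) (List.map (Equiv.refl _).invFun (ea a)) =
        ⟨some (some (entry p)), (v₀, false), onlyStack k₀ (ea a)⟩ :=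
      congrArg (TM2.Cfg.mk _ _) (onlyStack_eq k₀ _ _ (List.map_id _))
    have h₂ : haltList (machine p k₀ k₁ v₀) (List.map (Equiv.refl _).invFun (eb (f a))) =
        ⟨none, (v₀, false), onlyStack k₁ (eb (f a))⟩ :=
      congrArg (TM2.Cfg.mk _ _) (onlyStack_eq k₁ _ _ (List.map_id _))
    erw [h₁, Option.map_some, h₂]
    exact e

end Prog

end StackPrograms

/-! ### Coding a target state and an output by one word. -/

section Words

/-- The reflection of the interval `[0, m]`. -/
def reflect (m c : ℕ) : ℕ := if c ≤ m then m - c else c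

theorem reflect_reflect (m c : ℕ) : reflect m (reflect m c) = c := by
  unfold reflect
  split_ifs <;> omega

theorem reflect_le (m c : ℕ) : reflect m c ≤ m + c := by
  unfold reflect
  split_ifs <;> omega

/-- The word `0ᵃ` or `0ᵃ1v`. -/
def joinRun : ℕ → Option (List Bool) → List Bool
  | a, none => List.replicate a false
  | a, some v => List.replicate a false ++ true :: v

/-- The number of leading zeros of a word, and what follows the first `1`, if there is any. -/
def splitRun : List Bool → ℕ × Option (List Bool)
  | [] => (0, none)
  | true :: v => (0, some v)
  | false :: w => ((splitRun w).1 + 1, (splitRun w).2)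

theorem joinRun_splitRun (w : List Bool) : joinRun (splitRun w).1 (splitRun w).2 = w := by
  induction w with
  | nil => rfl
  | cons b w ih =>
    cases b
    · cases h : (splitRun w).2 <;> simp_all [splitRun, joinRun, List.replicate_succ]
    · rfl

theorem splitRun_joinRun (a : ℕ) (r : Option (List Bool)) : splitRun (joinRun a r) = (a, r) := by
  induction a with
  | zero => cases r <;> rfl
  | succ a ih => cases r <;> simp_all [splitRun, joinRun, List.replicate_succ]

/-- The reflection of the number of zeros, for words that contain a `1`. -/
def flipRun (m b : ℕ) : Option (List Bool) → ℕ
  | none => b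
  | some _ => reflect m b

theorem flipRun_flipRun (m b : ℕ) (r : Option (List Bool)) :
    flipRun m (flipRun m b r) r = b := by
  cases r
  · rfl
  · exact reflect_reflect m b

/-- The largest number of zeros with a short code, for transducers with `n` states. -/
def longRun (n : ℕ) : ℕ := 2 * n * n

/-- The code of a pair of a target state and an output, for transducers with `n` states. The code is
to be read backwards. -/
def encodePair (n : ℕ) (t : ℕ) (w : List Bool) : List Bool :=
  let r := splitRun w.reverse
  joinRun (n * flipRun (longRun n) r.1 r.2 + t) r.2

/-- The target state of a code. -/
def decodeTarget (n : ℕ) (u : List Bool) : ℕ := (splitRun u).1 % n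

/-- The output of a code. -/
def decodeOutput (n : ℕ) (u : List Bool) : List Bool :=
  (joinRun (flipRun (longRun n) ((splitRun u).1 / n) (splitRun u).2) (splitRun u).2).reverse

theorem decodeTarget_encodePair {n t : ℕ} (ht : t < n) (w : List Bool) :
    decodeTarget n (encodePair n t w) = t := by
  simp [decodeTarget, encodePair, splitRun_joinRun, Nat.mod_eq_of_lt ht]

theorem decodeOutput_encodePair {n t : ℕ} (ht : t < n) (w : List Bool) :
    decodeOutput n (encodePair n t w) = w := by
  have hn : 0 < n := by omega
  simp [decodeOutput, encodePair, splitRun_joinRun, Nat.mul_add_div hn, Nat.div_eq_of_lt ht,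
    flipRun_flipRun, joinRun_splitRun]

/-- Every number of zeros is a quotient and a remainder, so no word is excluded as a code. This
keeps arithmetic out of the domain of the encoding. -/
theorem encodePair_decode (n : ℕ) (u : List Bool) :
    encodePair n (decodeTarget n u) (decodeOutput n u) = u := by
  simp [decodeTarget, decodeOutput, encodePair, splitRun_joinRun, flipRun_flipRun,
    Nat.div_add_mod, joinRun_splitRun]

theorem length_joinRun_none (a : ℕ) : (joinRun a none).length = a := by simp [joinRun]

theorem length_joinRun_some (a : ℕ) (v : List Bool) :
    (joinRun a (some v)).length = a + v.length + 1 := by simp [joinRun]; omega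

/-- Outputs without a `1` are no longer than their codes, and other outputs are longer by
`longRun n` at most. -/
theorem length_decodeOutput_le (n : ℕ) (u : List Bool) :
    (decodeOutput n u).length ≤ u.length + longRun n * (decodeOutput n u).count true := by
  obtain ⟨a, r, rfl⟩ : ∃ a r, u = joinRun a r := ⟨_, _, (joinRun_splitRun u).symm⟩
  have hdiv : a / n ≤ a := Nat.div_le_self a n
  cases r with
  | none =>
    simp only [decodeOutput, splitRun_joinRun, flipRun, List.length_reverse, length_joinRun_none]
    omega
  | some v =>
    simp only [decodeOutput, splitRun_joinRun, flipRun, List.length_reverse, length_joinRun_some,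
      List.count_reverse]
    -- The `1` next to the run pays for the at most `longRun n` zeros that the reflection adds.
    have h1 : 1 ≤ (joinRun (reflect (longRun n) (a / n)) (some v)).count true := by
      simp only [joinRun, List.count_append, List.count_cons_self]
      omega
    have := Nat.mul_le_mul_left (longRun n) h1
    have := reflect_le (longRun n) (a / n)
    omega

end Words

/-! ### Self-delimiting serialization of the transition codes. -/

section Serialization

/-- The letters of a word, each preceded by a `1`. -/
def letterBits (u : List Bool) : List Bool := u.flatMap fun b => [true, b]

/-- A block for the input letter `i`, with a code to be read backwards. -/
def blockBits (i : Bool) (u : List Bool) : List Bool := false :: i :: letterBits u.reverse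

/-- The two blocks of a state. -/
def rowBits (r : List Bool × List Bool) : List Bool := blockBits false r.1 ++ blockBits true r.2

/-- The words of the blocks of a serialization, preceded by the letters before the first block. -/
def parseBits : List Bool → List Bool × List (List Bool)
  | true :: b :: l => (b :: (parseBits l).1, (parseBits l).2)
  | false :: _ :: l => ([], (parseBits l).1 :: (parseBits l).2)
  | _ => ([], [])

theorem parseBits_letterBits (u l : List Bool) :
    parseBits (letterBits u ++ l) = (u ++ (parseBits l).1, (parseBits l).2) := by
  induction u with
  | nil => rfl
  | cons b u ih => simp_all [letterBits, parseBits]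

theorem parseBits_rows (rs : List (List Bool × List Bool)) :
    parseBits (rs.flatMap rowBits) = ([], rs.flatMap fun r => [r.1.reverse, r.2.reverse]) := by
  induction rs with
  | nil => rfl
  | cons r rs ih => simp [rowBits, blockBits, parseBits, parseBits_letterBits, ih]

/-- `parseBits` recovers the block words up to reversal, and each row contributes exactly two of
them. -/
theorem flatMap_rowBits_injective :
    Function.Injective fun rs : List (List Bool × List Bool) => rs.flatMap rowBits := by
  intro rs rs' h
  have h' := congrArg (fun l => (parseBits l).2) h
  simp only [parseBits_rows] at h'
  clear h
  induction rs generalizing rs' with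
  | nil => cases rs' <;> simp_all
  | cons r rs ih =>
    cases rs' with
    | nil => simp at h'
    | cons r' rs' =>
      simp only [List.flatMap_cons, List.cons_append, List.nil_append, List.cons.injEq,
        List.reverse_inj] at h'
      rw [ih h'.2.2, Prod.ext h'.1 h'.2.1]

end Serialization

/-! ### The bijection between transducers and codes. -/

namespace Transducer

/-- The code of the transition with source `q` and input letter `i`. -/
def pairCode (T : Transducer) (q : Fin T.numStates) (i : Bool) : List Bool :=
  encodePair T.numStates (T.Δ q i).1 (T.Δ q i).2

/-- The codes of the transitions of a transducer, state by state. -/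
def rows (T : Transducer) : List (List Bool × List Bool) :=
  List.ofFn fun q => (T.pairCode q false, T.pairCode q true)

/-- The code of a transducer. -/
def code (T : Transducer) : List Bool := T.rows.flatMap rowBits

/-- The transducer with given codes of its transitions. -/
def ofRows (rs : List (List Bool × List Bool)) (h : 0 < rs.length) : Transducer where
  numStates := rs.length
  pos := h
  Δ q i := (⟨decodeTarget rs.length (bif i then rs[q].2 else rs[q].1), Nat.mod_lt _ h⟩,
    decodeOutput rs.length (bif i then rs[q].2 else rs[q].1))

theorem rows_ofRows (rs : List (List Bool × List Bool)) (h : 0 < rs.length) :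
    (ofRows rs h).rows = rs := by
  simp only [rows, pairCode, ofRows, encodePair_decode, cond_false, cond_true]
  exact List.ofFn_getElem ..

theorem rows_injective : Function.Injective rows := by
  rintro ⟨n, hn, Δ⟩ ⟨m, hm, Δ'⟩ h
  -- The number of states must be known before the pairs can be decoded, as their coding depends on
  -- it.
  obtain rfl : n = m := by simpa [rows] using congrArg List.length h
  have h' := List.ofFn_injective h
  have hcode : ∀ q i, encodePair n (Δ q i).1 (Δ q i).2 = encodePair n (Δ' q i).1 (Δ' q i).2 := by
    intro q i
    have := congrFun h' q
    cases i
    · exact congrArg Prod.fst this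
    · exact congrArg Prod.snd this
  congr
  funext q i
  refine Prod.ext (Fin.ext ?_) ?_
  · simpa [decodeTarget_encodePair] using congrArg (decodeTarget n) (hcode q i)
  · simpa [decodeOutput_encodePair] using congrArg (decodeOutput n) (hcode q i)

theorem code_injective : Function.Injective code :=
  flatMap_rowBits_injective.comp rows_injective

/-- By `rows_ofRows` all block words are allowed, so being a code is a matter of block structure
alone. -/
theorem mem_range_code {w : List Bool} :
    w ∈ Set.range code ↔ ∃ rs, rs ≠ [] ∧ w = rs.flatMap rowBits := by
  constructor
  · rintro ⟨T, rfl⟩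
    refine ⟨T.rows, ?_, rfl⟩
    have := T.pos
    rw [← List.length_pos_iff]
    simpa [rows]
  · rintro ⟨rs, hrs, rfl⟩
    exact ⟨ofRows rs (List.length_pos_iff.2 hrs), by rw [code, rows_ofRows]⟩

end Transducer

/-- The encoding of all transducers by their codes. -/
noncomputable def runEncoding : Encoding where
  dom := Set.range Transducer.code
  decode := (Equiv.ofInjective _ Transducer.code_injective).symm
  bijective := Equiv.bijective _

theorem code_decode_runEncoding (c : runEncoding.dom) :
    (runEncoding.decode c).code = (c : List Bool) :=
  Equiv.apply_ofInjective_symm Transducer.code_injective c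

theorem exists_decode_runEncoding (T : Transducer) :
    ∃ c : runEncoding.dom, (c : List Bool) = T.code ∧ runEncoding.decode c = T :=
  ⟨⟨T.code, T, rfl⟩, rfl, Equiv.ofInjective_symm_apply Transducer.code_injective T⟩

/-! ### Strictness of the hierarchy. -/

section Hierarchy

theorem length_letterBits (u : List Bool) : (letterBits u).length = 2 * u.length := by
  simp [letterBits, mul_comm]

theorem length_rowBits (r : List Bool × List Bool) :
    (rowBits r).length = 4 + 2 * (r.1.length + r.2.length) := by
  simp [rowBits, blockBits, length_letterBits]; omega

theorem Transducer.length_code (T : Transducer) :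
    T.code.length = 4 * T.numStates +
      2 * ∑ q, ((T.pairCode q false).length + (T.pairCode q true).length) := by
  simp [code, rows, List.length_flatMap, length_rowBits, List.map_ofFn, Function.comp_def,
    List.sum_ofFn, Finset.sum_add_distrib, mul_add, Finset.mul_sum, mul_comm]

/-- The letters of a code that exceed its markers. -/
def Transducer.weight (T : Transducer) : ℕ :=
  ∑ q, ((T.pairCode q false).length + (T.pairCode q true).length)

theorem Transducer.length_pairCode_le (T : Transducer) (q : Fin T.numStates) (i : Bool) :
    (T.pairCode q i).length ≤ T.weight := by
  refine le_trans ?_ (Finset.single_le_sum (f := fun q =>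
    (T.pairCode q false).length + (T.pairCode q true).length) (fun _ _ => Nat.zero_le _)
    (Finset.mem_univ q))
  cases i
  · exact Nat.le_add_right _ _
  · exact Nat.le_add_left _ _

theorem Transducer.length_output_le (T : Transducer) (q : Fin T.numStates) (i : Bool) :
    (T.Δ q i).2.length ≤ T.weight + longRun T.numStates * (T.Δ q i).2.count true := by
  have h := length_decodeOutput_le T.numStates (T.pairCode q i)
  rw [Transducer.pairCode, decodeOutput_encodePair (T.Δ q i).1.isLt] at h
  exact h.trans (Nat.add_le_add_right (T.length_pairCode_le q i) _)

/-- The bound for one transition is additive along a run. The reflection is charged to the ones of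
the output and not to the steps, so for an output with a single `1` it counts only once. -/
theorem Transducer.length_runFrom_le (T : Transducer) (q : Fin T.numStates) (p : List Bool) :
    (T.runFrom q p).length ≤
      T.weight * p.length + longRun T.numStates * (T.runFrom q p).count true := by
  induction p generalizing q with
  | nil => simp [runFrom]
  | cons i p ih =>
    have h₁ := T.length_output_le q i
    have h₂ := ih (T.Δ q i).1
    simp only [runFrom, List.length_append, List.count_append, List.length_cons]
    linarith

/-- The word `10ᵐ`, with `m = longRun n`. -/
def oneLongRun (n : ℕ) : List Bool := true :: List.replicate (longRun n) false

/-- The transducer with `n` states that outputs `oneLongRun n` on the letter `0` in its start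
state. -/
def longRunTransducer (n : ℕ) (hn : 0 < n) : Transducer where
  numStates := n
  pos := hn
  Δ q i := (⟨0, hn⟩, if q.val = 0 ∧ i = false then oneLongRun n else [])

theorem encodePair_nil (n : ℕ) : encodePair n 0 [] = [] := by
  simp [encodePair, splitRun, flipRun, joinRun]

/-- The final run has the length `longRun n`, which is reflected to `0`, and the target `0` adds no
zeros. -/
theorem encodePair_oneLongRun (n : ℕ) : encodePair n 0 (oneLongRun n) = [true] := by
  have : (oneLongRun n).reverse = joinRun (longRun n) (some []) := by
    simp [oneLongRun, joinRun]
  rw [encodePair, this, splitRun_joinRun]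
  simp [flipRun, reflect, joinRun]

theorem length_code_longRunTransducer (n : ℕ) (hn : 0 < n) :
    (longRunTransducer n hn).code.length = 4 * n + 2 := by
  have h : ∀ q i, ((longRunTransducer n hn).pairCode q i).length =
      if q = (longRunTransducer n hn).start ∧ i = false then 1 else 0 := by
    intro q i
    have hq : q = (longRunTransducer n hn).start ∧ i = false ↔ q.val = 0 ∧ i = false := by
      rw [Fin.ext_iff]; rfl
    change (encodePair n 0 (if q.val = 0 ∧ i = false then oneLongRun n else [])).length = _
    by_cases h0 : q.val = 0 ∧ i = false
    · rw [if_pos h0, if_pos (hq.2 h0), encodePair_oneLongRun]; rfl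
    · rw [if_neg h0, if_neg (mt hq.1 h0), encodePair_nil]; rfl
  rw [Transducer.length_code]
  simp only [h, and_true, Bool.true_eq_false, and_false, if_false, add_zero]
  rw [Finset.sum_ite_eq' Finset.univ, if_pos (Finset.mem_univ _)]
  rfl

theorem run_longRunTransducer (n : ℕ) (hn : 0 < n) :
    (longRunTransducer n hn).run [false] = oneLongRun n := by
  simp [Transducer.run, Transducer.runFrom, longRunTransducer, Transducer.start]

/-- Descriptions of `oneLongRun n` by transducers whose number of states is not `n` are long. -/
theorem lt_length_of_run_eq (T : Transducer) (p : List Bool) {n : ℕ}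
    (h : T.run p = oneLongRun n) (hT : T.numStates ≠ n) :
    4 * n + 3 < T.code.length + p.length := by
  have hlen := T.length_code
  rw [← Transducer.weight] at hlen
  rcases lt_or_gt_of_ne hT with hlt | hgt
  · have hrun := T.length_runFrom_le T.start p
    rw [← Transducer.run, h] at hrun
    simp only [oneLongRun, List.length_cons, List.length_replicate, List.count_cons,
      List.count_replicate, longRun] at hrun
    simp only [beq_self_eq_true, if_true, Nat.zero_add, mul_one, beq_iff_eq, Bool.false_eq_true,
      if_false] at hrun
    have hm := T.pos
    rw [hlen]
    generalize T.weight = e at *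
    generalize p.length = k at *
    generalize T.numStates = m at *
    obtain ⟨d, rfl⟩ := Nat.exists_eq_add_of_lt hlt
    -- Here `n = m + d + 1`, and `hrun` gives `e * k ≥ 2(d + 1)(2m + d + 1) + 1`. As `m ≥ 1`, it
    -- follows that `(2e + k)² ≥ 8ek ≥ 16(d + 1)(d + 3) + 8 > (4d + 7)²`, whereas a short
    -- description would have `2e + k ≤ 4n + 3 - 4m = 4d + 7`.
    by_contra hcon
    have hle : 2 * e + k ≤ 4 * d + 7 := by omega
    have hsq : (2 * e + k) * (2 * e + k) ≤ (4 * d + 7) * (4 * d + 7) := Nat.mul_le_mul hle hle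
    zify at *
    nlinarith [sq_nonneg (2 * (e : ℤ) - k),
      mul_nonneg (Int.natCast_nonneg m) (Int.natCast_nonneg d)]
  -- The markers alone take `4 * (n + 1)` bits.
  · omega

theorem complexity_oneLongRun_le (n : ℕ) (hn : 0 < n) :
    runEncoding.complexity (oneLongRun n) ≤ 4 * n + 3 := by
  obtain ⟨c, hc, hd⟩ := exists_decode_runEncoding (longRunTransducer n hn)
  refine Nat.sInf_le ⟨c, [false], ?_, ?_⟩
  · rw [hd, run_longRunTransducer]
  · simp [hc, length_code_longRunTransducer]

theorem numStates_of_minimal {n : ℕ} (hn : 0 < n) (c : runEncoding.dom) (p : List Bool)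
    (hrun : (runEncoding.decode c).run p = oneLongRun n)
    (hlen : (c : List Bool).length + p.length = runEncoding.complexity (oneLongRun n)) :
    (runEncoding.decode c).numStates = n := by
  by_contra hne
  have := lt_length_of_run_eq _ p hrun hne
  rw [code_decode_runEncoding, hlen] at this
  exact absurd (complexity_oneLongRun_le n hn) (by omega)

theorem level_runEncoding_ssubset {n : ℕ} (hn : 1 ≤ n) :
    runEncoding.level (n - 1) ⊂ runEncoding.level n := by
  refine ⟨?_, fun hsub => ?_⟩
  · rintro x ⟨c, p, h₁, h₂, h₃⟩
    exact ⟨c, p, h₁, h₂, by omega⟩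
  · obtain ⟨c, hc, hd⟩ := exists_decode_runEncoding (longRunTransducer n hn)
    have hne : {k | ∃ (c : runEncoding.dom) (p : List Bool),
        (runEncoding.decode c).run p = oneLongRun n ∧
          (c : List Bool).length + p.length = k}.Nonempty :=
      ⟨_, c, [false], by rw [hd, run_longRunTransducer], rfl⟩
    -- A minimal description exists because some description does. It need not be the one by
    -- `longRunTransducer`; only its number of states matters.
    obtain ⟨c, p, hrun, hlen⟩ := Nat.sInf_mem hne
    have hmem : oneLongRun n ∈ runEncoding.level n :=
      ⟨c, p, hrun, hlen, (numStates_of_minimal hn c p hrun hlen).le⟩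
    obtain ⟨c', p', hrun', hlen', hle⟩ := hsub hmem
    have := numStates_of_minimal hn c' p' hrun' hlen'
    omega

end Hierarchy

/-! ### Deciding the set of codes by a finite automaton. -/

section Domain

/-- The states of an automaton for the set of codes. -/
inductive CodeState
  | start
  | marker (i : Bool)
  | block (i : Bool)
  | letter (i : Bool)
  | dead
  deriving DecidableEq, Fintype

namespace CodeState

/-- The transition function: in the state `block i` the last marker was that of `i`, and the state
`marker i` expects the second bit of the marker of `!i`. -/
def next : CodeState → Bool → CodeState
  | start, false => marker true
  | start, true => dead
  | marker true, false => block false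
  | marker false, true => block true
  | marker _, _ => dead
  | block i, false => marker i
  | block i, true => letter i
  | letter i, _ => block i
  | dead, _ => dead

theorem foldl_dead (w : List Bool) : w.foldl next dead = dead := by
  induction w with
  | nil => rfl
  | cons b w ih => exact ih

theorem foldl_letterBits (i : Bool) (u : List Bool) :
    (letterBits u).foldl next (block i) = block i := by
  induction u with
  | nil => rfl
  | cons b u ih => simpa [letterBits, next] using ih

theorem foldl_rows (rs : List (List Bool × List Bool)) :
    (rs.flatMap rowBits).foldl next (block true) = block true := by
  induction rs with
  | nil => rfl
  | cons r rs ih => simpa [rowBits, blockBits, next, foldl_letterBits] using ih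

/-- The two claims describe what may follow inside a block: `u` is the rest of the current block,
and after a first block the second block of the same row is still to come. They are proved together,
two bits at a time, since each marker passes from one to the other. -/
theorem exists_rows_of_foldl : ∀ w : List Bool,
    (w.foldl next (block true) = block true →
      ∃ u rs, w = letterBits u ++ List.flatMap rowBits rs) ∧
    (w.foldl next (block false) = block true →
      ∃ u v rs, w = letterBits u ++ false :: true :: (letterBits v ++ List.flatMap rowBits rs))
  | [] => ⟨fun _ => ⟨[], [], rfl⟩, fun h => by simp at h⟩
  | [b] => by cases b <;> simp [next]
  | true :: b :: w => by
    obtain ⟨h₁, h₂⟩ := exists_rows_of_foldl w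
    refine ⟨fun h => ?_, fun h => ?_⟩
    · obtain ⟨u, rs, rfl⟩ := h₁ (by simpa [next] using h)
      exact ⟨b :: u, rs, rfl⟩
    · obtain ⟨u, v, rs, rfl⟩ := h₂ (by simpa [next] using h)
      exact ⟨b :: u, v, rs, rfl⟩
  | false :: true :: w => by
    obtain ⟨h₁, h₂⟩ := exists_rows_of_foldl w
    refine ⟨fun h => ?_, fun h => ?_⟩
    · simp [next, foldl_dead] at h
    · obtain ⟨u, rs, rfl⟩ := h₁ (by simpa [next] using h)
      exact ⟨[], u, rs, rfl⟩
  | false :: false :: w => by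
    obtain ⟨h₁, h₂⟩ := exists_rows_of_foldl w
    refine ⟨fun h => ?_, fun h => ?_⟩
    · obtain ⟨u, v, rs, rfl⟩ := h₂ (by simpa [next] using h)
      exact ⟨[], (u.reverse, v.reverse) :: rs, by simp [rowBits, blockBits, letterBits]⟩
    · simp [next, foldl_dead] at h

/-- The separate state `start` excludes the empty word, which would be a transducer without states,
and letters before the first marker. -/
theorem foldl_start_eq_iff (w : List Bool) :
    w.foldl next start = block true ↔ w ∈ Set.range Transducer.code := by
  rw [Transducer.mem_range_code]
  constructor
  · match w with
    | [] => simp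
    | [b] => cases b <;> simp [next]
    | true :: b :: w => simp [next, foldl_dead]
    | false :: true :: w => simp [next, foldl_dead]
    | false :: false :: w =>
      intro h
      obtain ⟨u, v, rs, rfl⟩ := (exists_rows_of_foldl w).2 (by simpa [next] using h)
      exact ⟨(u.reverse, v.reverse) :: rs, by simp, by simp [rowBits, blockBits]⟩
  · rintro ⟨rs, hrs, rfl⟩
    cases rs with
    | nil => exact absurd rfl hrs
    | cons r rs => simp [rowBits, blockBits, next, foldl_letterBits, foldl_rows]

end CodeState

open CodeState in
/-- A program running the automaton. -/
def acceptCode : Prog (fun _ : Unit => Bool) CodeState :=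
  .seq (.loop () (fun v o => o.elim v (next v)) (fun _ o => o.isSome) .skip)
    (.push () fun v => decide (v = block true))

theorem run_acceptCode_loop (v : CodeState) (w : List Bool) :
    Prog.Run (.loop () (fun v o => o.elim v (CodeState.next v)) (fun _ o => o.isSome) .skip) v
      (fun _ : Unit => w) (2 * w.length + 1) (w.foldl CodeState.next v) (fun _ => []) := by
  have hupd : ∀ w w' : List Bool, Function.update (fun _ : Unit => w) () w' = fun _ => w' :=
    fun w w' => by funext k; simp
  induction w generalizing v with
  | nil =>
    have h := Prog.Run.loop_false (k := ()) (f := fun v o => o.elim v (CodeState.next v))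
      (c := fun (_ : CodeState) (o : Option Bool) => o.isSome) (p := .skip) (v := v)
      (S := fun _ : Unit => ([] : List Bool)) rfl
    rw [hupd] at h
    exact h
  | cons b w ih =>
    refine (Prog.Run.loop_true (t := 1) (t' := 2 * w.length + 1) rfl (.skip _ _) ?_).mono ?_
    · rw [hupd]
      exact ih _
    · simp only [List.length_cons]; omega

theorem polyTime_mem_dom : Nonempty (TM2ComputableInPolyTime (fun w : List Bool => w)
    Computability.encodeBool (fun w : List Bool =>
      @decide (w ∈ Set.range Transducer.code) (Classical.propDecidable _))) := by
  have hone : ∀ w : List Bool, Prog.onlyStack (Γ := fun _ : Unit => Bool) () w = fun _ => w :=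
    fun w => by funext k; simp [Prog.onlyStack]
  refine ⟨Prog.polyTime (k₀ := ()) (k₁ := ()) acceptCode CodeState.start _ _ _
    (2 * Polynomial.X + 2) fun w => ?_⟩
  refine ⟨w.foldl CodeState.next CodeState.start, ?_⟩
  have h := (run_acceptCode_loop CodeState.start w).seq
    (.push () (fun v => decide (v = CodeState.block true)) _ _)
  simp only [hone]
  convert h using 1
  · rfl
  · simp
  · funext k
    simp [Computability.encodeBool, CodeState.foldl_start_eq_iff]

end Domain

/-! ### Unary counters on stacks. -/

section Store

/-- The unary counters of the decoder. -/
inductive Pile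
  | n | q | a | t | c | p | d | u | x | r
  deriving DecidableEq

instance : Fintype Pile where
  elems := {.n, .q, .a, .t, .c, .p, .d, .u, .x, .r}
  complete i := by cases i <;> simp

/-- The stacks of the decoder. -/
inductive Stack
  | inp
  | out
  | buf
  | pile (i : Pile)
  deriving DecidableEq, Fintype

/-- The stack alphabets of the decoder. -/
@[reducible]
def Stack.Sym : Stack → Type
  | inp => Bool
  | out => Option Bool
  | buf => Bool × Bool
  | pile _ => Unit

/-- The contents of the stacks of the decoder. -/
structure Store where
  inp : List Bool := []
  out : List (Option Bool) := []
  buf : List (Bool × Bool) := []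
  n : ℕ := 0
  q : ℕ := 0
  a : ℕ := 0
  t : ℕ := 0
  c : ℕ := 0
  p : ℕ := 0
  d : ℕ := 0
  u : ℕ := 0
  x : ℕ := 0
  r : ℕ := 0

namespace Store

/-- The value of a counter. -/
def get (s : Store) : Pile → ℕ
  | .n => s.n
  | .q => s.q
  | .a => s.a
  | .t => s.t
  | .c => s.c
  | .p => s.p
  | .d => s.d
  | .u => s.u
  | .x => s.x
  | .r => s.r

/-- Change the value of a counter. -/
def set (s : Store) (i : Pile) (m : ℕ) : Store :=
  match i with
  | .n => { s with n := m }
  | .q => { s with q := m }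
  | .a => { s with a := m }
  | .t => { s with t := m }
  | .c => { s with c := m }
  | .p => { s with p := m }
  | .d => { s with d := m }
  | .u => { s with u := m }
  | .x => { s with x := m }
  | .r => { s with r := m }

/-- The stacks described by a store. -/
def toStacks (s : Store) : ∀ k : Stack, List k.Sym
  | .inp => s.inp
  | .out => s.out
  | .buf => s.buf
  | .pile i => List.replicate (s.get i) ()

theorem get_set_self (s : Store) (i : Pile) (m : ℕ) : (s.set i m).get i = m := by
  cases i <;> rfl

theorem get_set_ne (s : Store) {i j : Pile} (h : i ≠ j) (m : ℕ) : (s.set i m).get j = s.get j := by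
  cases i <;> cases j <;> first | rfl | exact absurd rfl h

theorem set_set (s : Store) (i : Pile) (m m' : ℕ) : (s.set i m).set i m' = s.set i m' := by
  cases i <;> rfl

theorem set_get (s : Store) (i : Pile) : s.set i (s.get i) = s := by
  cases i <;> rfl

theorem set_comm (s : Store) {i j : Pile} (h : i ≠ j) (m m' : ℕ) :
    (s.set i m).set j m' = (s.set j m').set i m := by
  cases i <;> cases j <;> first | rfl | exact absurd rfl h

theorem out_set (s : Store) (i : Pile) (m : ℕ) : (s.set i m).out = s.out := by
  cases i <;> rfl

/-- A list over `Unit` is determined by its length, so it suffices that a store records numbers. -/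
theorem update_pile (s : Store) (i : Pile) (l : List (Stack.pile i).Sym) :
    Function.update s.toStacks (.pile i) l = (s.set i l.length).toStacks := by
  funext k
  by_cases h : k = .pile i
  · subst h
    rw [Function.update_self]
    simp only [toStacks, get_set_self]
    exact List.eq_replicate_iff.2 ⟨rfl, fun _ _ => rfl⟩
  · rw [Function.update_of_ne h]
    cases k with
    | pile j => simp only [toStacks]; rw [get_set_ne _ (fun hij => h (by rw [hij]))]
    | _ => cases i <;> rfl

theorem update_inp (s : Store) (l : List Stack.inp.Sym) :
    Function.update s.toStacks .inp l = { s with inp := l }.toStacks := by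
  funext k
  cases k <;> rfl

theorem update_out (s : Store) (l : List Stack.out.Sym) :
    Function.update s.toStacks .out l = { s with out := l }.toStacks := by
  funext k
  cases k <;> rfl

theorem update_buf (s : Store) (l : List Stack.buf.Sym) :
    Function.update s.toStacks .buf l = { s with buf := l }.toStacks := by
  funext k
  cases k <;> rfl

end Store

/-- The register of the decoder: the last symbol read, and a flag. -/
abbrev Reg : Type := (Bool × Bool) × Bool

/-- Runs between stores. -/
def Exec (p : Prog Stack.Sym Reg) (v : Reg) (s : Store) (t : ℕ) (v' : Reg) (s' : Store) : Prop :=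
  Prog.Run p v s.toStacks t v' s'.toStacks

/-- Runs between stores, with an unspecified final register. -/
def ExecTo (p : Prog Stack.Sym Reg) (v : Reg) (s : Store) (t : ℕ) (s' : Store) : Prop :=
  ∃ v', Exec p v s t v' s'

theorem Exec.congr {p v s t v' s' t' s''} (h : Exec p v s t v' s') (hs : s' = s'')
    (ht : t ≤ t') : Exec p v s t' v' s'' := by
  subst hs
  exact h.mono ht

theorem Exec.congr_register {p v s t v' s' t' v'' s''} (h : Exec p v s t v' s') (hv : v' = v'')
    (hs : s' = s'') (ht : t ≤ t') : Exec p v s t' v'' s'' := by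
  subst hv
  exact h.congr hs ht

theorem ExecTo.congr {p v s t s' t' s''} (h : ExecTo p v s t s') (hs : s' = s'')
    (ht : t ≤ t') : ExecTo p v s t' s'' := by
  obtain ⟨v', h⟩ := h
  exact ⟨v', h.congr hs ht⟩

theorem Exec.seq {p q v s t v' s' t' v'' s''} (h : Exec p v s t v' s')
    (h' : Exec q v' s' t' v'' s'') : Exec (.seq p q) v s (t + t') v'' s'' :=
  Prog.Run.seq h h'

theorem Exec.seq_of_eq {p q v s t v' s' s₁ t' v'' s''} (h : Exec p v s t v' s') (hs : s' = s₁)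
    (h' : Exec q v' s₁ t' v'' s'') : Exec (.seq p q) v s (t + t') v'' s'' := by
  subst hs
  exact h.seq h'

theorem Exec.seqTo {p q v s t v' s' t' s''} (h : Exec p v s t v' s')
    (h' : ExecTo q v' s' t' s'') : ExecTo (.seq p q) v s (t + t') s'' := by
  obtain ⟨v'', h'⟩ := h'
  exact ⟨v'', h.seq h'⟩

theorem ExecTo.seq {p q v s t s' t' s''} (h : ExecTo p v s t s')
    (h' : ∀ v', ExecTo q v' s' t' s'') : ExecTo (.seq p q) v s (t + t') s'' := by
  obtain ⟨v', h⟩ := h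
  exact h.seqTo (h' v')

theorem Exec.to {p v s t v' s'} (h : Exec p v s t v' s') : ExecTo p v s t s' := ⟨v', h⟩

theorem exec_ite_true {c p q v s t v' s'} (hc : c v = true) (h : Exec p v s t v' s') :
    Exec (.ite c p q) v s (t + 1) v' s' := .ite_true hc h

theorem exec_ite_false {c p q v s t v' s'} (hc : c v = false) (h : Exec q v s t v' s') :
    Exec (.ite c p q) v s (t + 1) v' s' := .ite_false hc h

theorem exec_skip (v s) : Exec .skip v s 1 v s := .skip _ _

theorem exec_load (f v s) : Exec (.load f) v s 1 (f v) s := .load _ _ _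

/-- Add a mark to a pile. -/
def mark (i : Pile) : Prog Stack.Sym Reg := .push (.pile i) fun _ => ()

/-- Write a symbol. -/
def emit (f : Reg → Option Bool) : Prog Stack.Sym Reg := .push .out f

/-- Empty a pile, running the body for each mark. -/
def forPile (i : Pile) (p : Prog Stack.Sym Reg) : Prog Stack.Sym Reg :=
  .loop (.pile i) (fun v _ => v) (fun _ o => o.isSome) p

/-- Remove a mark and run `p`, or run `q` if there is none. -/
def ifPile (i : Pile) (p q : Prog Stack.Sym Reg) : Prog Stack.Sym Reg :=
  .popIte (.pile i) (fun v _ => v) (fun _ o => o.isSome) p q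

theorem exec_mark (i v s) : Exec (mark i) v s 1 v (s.set i (s.get i + 1)) := by
  have h := Prog.Run.push (.pile i) (fun _ : Reg => ()) v s.toStacks
  rw [Store.update_pile] at h
  simp only [Store.toStacks, List.length_cons, List.length_replicate] at h
  exact h

theorem exec_emit (f v s) : Exec (emit f) v s 1 v { s with out := f v :: s.out } := by
  have h := Prog.Run.push .out f v s.toStacks
  rw [Store.update_out] at h
  exact h

theorem head_pile_zero {s : Store} {i : Pile} (h : s.get i = 0) :
    (s.toStacks (.pile i)).head?.isSome = false := by simp [Store.toStacks, h]

theorem head_pile_succ {s : Store} {i : Pile} {m : ℕ} (h : s.get i = m + 1) :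
    (s.toStacks (.pile i)).head?.isSome = true := by
  simp only [Store.toStacks, h, List.replicate_succ]
  rfl

theorem update_tail_pile (s : Store) (i : Pile) :
    Function.update s.toStacks (.pile i) (s.toStacks (.pile i)).tail =
      (s.set i (s.get i - 1)).toStacks := by
  rw [Store.update_pile]
  congr 2
  rw [List.length_tail]
  exact congrArg (· - 1) List.length_replicate

theorem exec_forPile_zero {i p v s} (h : s.get i = 0) : Exec (forPile i p) v s 1 v s := by
  have h' := Prog.Run.loop_false (f := fun (v : Reg) _ => v) (p := p) (v := v)
    (c := fun _ o => o.isSome) (head_pile_zero h)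
  -- The failing test still pops; truncated subtraction reflects that an empty pile stays empty.
  rw [update_tail_pile, h, show 0 - 1 = s.get i from h.symm, Store.set_get] at h'
  exact h'

theorem exec_forPile_succ {i p v s t v' s' t' v'' s'' m} (h : s.get i = m + 1)
    (h₁ : Exec p v (s.set i m) t v' s') (h₂ : Exec (forPile i p) v' s' t' v'' s'') :
    Exec (forPile i p) v s (t + 1 + t') v'' s'' := by
  refine Prog.Run.loop_true (head_pile_succ h) ?_ h₂
  rw [update_tail_pile, h]
  exact h₁

theorem execTo_forPile_succ {i p v s t s' t' s'' m} (h : s.get i = m + 1)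
    (h₁ : ExecTo p v (s.set i m) t s') (h₂ : ∀ v', ExecTo (forPile i p) v' s' t' s'') :
    ExecTo (forPile i p) v s (t + 1 + t') s'' := by
  obtain ⟨v', h₁⟩ := h₁
  obtain ⟨v'', h₂⟩ := h₂ v'
  exact ⟨v'', exec_forPile_succ h h₁ h₂⟩

theorem exec_ifPile_zero {i p q v s t v' s'} (h : s.get i = 0) (h' : Exec q v s t v' s') :
    Exec (ifPile i p q) v s (t + 1) v' s' := by
  refine Prog.Run.popIte_false (head_pile_zero h) ?_
  rw [update_tail_pile, h, show 0 - 1 = s.get i from h.symm, Store.set_get]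
  exact h'

theorem exec_ifPile_succ {i p q v s t v' s' m} (h : s.get i = m + 1)
    (h' : Exec p v (s.set i m) t v' s') : Exec (ifPile i p q) v s (t + 1) v' s' := by
  refine Prog.Run.popIte_true (head_pile_succ h) ?_
  rw [update_tail_pile, h]
  exact h'

theorem exec_clear (i v s) : Exec (forPile i .skip) v s (2 * s.get i + 1) v (s.set i 0) := by
  obtain ⟨m, hm⟩ : ∃ m, s.get i = m := ⟨_, rfl⟩
  induction m generalizing s with
  | zero => exact (exec_forPile_zero hm).congr (by rw [← hm, Store.set_get]) (by omega)
  | succ m ih =>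
    refine (exec_forPile_succ hm (exec_skip _ _) (ih _ (Store.get_set_self _ _ _))).congr ?_ ?_
    · rw [Store.set_set]
    · rw [Store.get_set_self]; omega

theorem exec_move {i j : Pile} (hij : i ≠ j) (v s) :
    Exec (forPile i (mark j)) v s (2 * s.get i + 1) v
      ((s.set i 0).set j (s.get j + s.get i)) := by
  obtain ⟨m, hm⟩ : ∃ m, s.get i = m := ⟨_, rfl⟩
  induction m generalizing s with
  | zero =>
    refine (exec_forPile_zero hm).congr ?_ (by omega)
    rw [hm, Nat.add_zero, ← hm, Store.set_get, Store.set_get]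
  | succ m ih =>
    have hm' : ((s.set i m).set j ((s.set i m).get j + 1)).get i = m := by
      rw [Store.get_set_ne _ hij.symm, Store.get_set_self]
    refine (exec_forPile_succ hm (exec_mark _ _ _) (ih _ hm')).congr ?_ ?_
    · rw [hm', Store.get_set_self, Store.get_set_ne _ hij, Store.set_comm _ hij.symm,
        Store.set_set, Store.set_set, hm, Nat.add_assoc, Nat.add_comm 1]
    · rw [hm']; omega

theorem exec_moveTwo {i j k : Pile} (hij : i ≠ j) (hik : i ≠ k) (hjk : j ≠ k) (v s) :
    Exec (forPile i (.seq (mark j) (mark k))) v s (3 * s.get i + 1) v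
      (((s.set i 0).set j (s.get j + s.get i)).set k (s.get k + s.get i)) := by
  obtain ⟨m, hm⟩ : ∃ m, s.get i = m := ⟨_, rfl⟩
  induction m generalizing s with
  | zero =>
    refine (exec_forPile_zero hm).congr ?_ (by omega)
    rw [hm, Nat.add_zero, Nat.add_zero, ← hm, Store.set_get, Store.set_get, Store.set_get]
  | succ m ih =>
    refine (exec_forPile_succ hm ((exec_mark j _ _).seq (exec_mark k _ _)) (ih _ ?_)).congr ?_ ?_
    · simp only [Store.get_set_ne _ hij.symm, Store.get_set_ne _ hik.symm, Store.get_set_self]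
    · simp only [Store.get_set_ne _ hij, Store.get_set_ne _ hik, Store.get_set_ne _ hij.symm,
        Store.get_set_ne _ hik.symm, Store.get_set_ne _ hjk, Store.get_set_ne _ hjk.symm,
        Store.get_set_self, Store.set_comm _ hij.symm, Store.set_comm _ hik.symm,
        Store.set_comm _ hjk.symm, Store.set_set, hm]
      congr 1
      · congr 1; omega
      · omega
    · simp only [Store.get_set_ne _ hij.symm, Store.get_set_ne _ hik.symm, Store.get_set_self]
      omega

/-- Write a zero. -/
def emitZero : Prog Stack.Sym Reg := emit fun _ => some false

theorem set_out (s : Store) (i : Pile) (m : ℕ) (l : List (Option Bool)) :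
    { s.set i m with out := l } = { s with out := l }.set i m := by
  cases i <;> rfl

theorem exec_emitZeros (i v s) :
    Exec (forPile i emitZero) v s (2 * s.get i + 1) v
      { s.set i 0 with out := List.replicate (s.get i) (some false) ++ s.out } := by
  obtain ⟨m, hm⟩ : ∃ m, s.get i = m := ⟨_, rfl⟩
  induction m generalizing s with
  | zero =>
    refine (exec_forPile_zero hm).congr ?_ (by omega)
    rw [hm, ← hm, Store.set_get, hm]; rfl
  | succ m ih =>
    have hm' : ({ s.set i m with out := some false :: (s.set i m).out } : Store).get i = m := by
      cases i <;> rfl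
    refine (exec_forPile_succ hm (exec_emit _ _ _) (ih _ hm')).congr ?_ ?_
    · rw [hm', hm, List.replicate_succ', Store.out_set, set_out, set_out,
        Store.set_set, set_out, Store.out_set]
      simp [set_out]
    · rw [hm']; omega

theorem exec_emitZerosMove {i j : Pile} (hij : i ≠ j) (v s) :
    Exec (forPile i (.seq emitZero (mark j))) v s (3 * s.get i + 1) v
      { (s.set i 0).set j (s.get j + s.get i) with
        out := List.replicate (s.get i) (some false) ++ s.out } := by
  obtain ⟨m, hm⟩ : ∃ m, s.get i = m := ⟨_, rfl⟩
  induction m generalizing s with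
  | zero =>
    refine (exec_forPile_zero hm).congr ?_ (by omega)
    rw [hm, Nat.add_zero, ← hm, Store.set_get, Store.set_get, hm]; rfl
  | succ m ih =>
    have hget : ∀ (s : Store) l k, ({ s with out := l } : Store).get k = s.get k := by
      intro s l k; cases k <;> rfl
    refine (exec_forPile_succ hm ((exec_emit _ _ _).seq (exec_mark j _ _)) (ih _ ?_)).congr ?_ ?_
    · rw [Store.get_set_ne _ hij.symm, hget, Store.get_set_self]
    · simp only [Store.get_set_ne _ hij.symm, hget, Store.get_set_self, Store.get_set_ne _ hij,
        Store.out_set, set_out, Store.set_comm _ hij.symm, Store.set_set, hm,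
        List.replicate_succ', List.append_assoc, List.cons_append, List.nil_append,
        Nat.add_assoc, Nat.add_comm 1]
    · rw [Store.get_set_ne _ hij.symm, hget, Store.get_set_self]; omega

end Store

/-! ### Computing the list of transitions from a code. -/

section Decoder

/-- Pop symbols into the register and run the body as long as they satisfy `c`. -/
def readWhile (c : Bool × Bool → Bool) (p : Prog Stack.Sym Reg) : Prog Stack.Sym Reg :=
  .loop .buf (fun v o => (o.getD (false, false), v.2)) (fun _ o => o.any c) p

theorem exec_readWhile_false {c p v s x l} (hs : s.buf = x :: l) (hx : c x = false) :
    Exec (readWhile c p) v s 1 (x, v.2) { s with buf := l } := by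
  have h := Prog.Run.loop_false (k := Stack.buf)
    (f := fun (v : Reg) o => (o.getD (false, false), v.2))
    (c := fun _ o => o.any c) (v := v) (S := s.toStacks) (p := p)
    (by simp only [Store.toStacks, hs, List.head?_cons]; exact hx)
  rw [Store.update_buf] at h
  simp only [Store.toStacks, hs, List.head?_cons] at h
  exact h

theorem exec_readWhile_true {c p v s x l t v' s' t' v'' s''} (hs : s.buf = x :: l)
    (hx : c x = true) (h₁ : Exec p (x, v.2) { s with buf := l } t v' s')
    (h₂ : Exec (readWhile c p) v' s' t' v'' s'') :
    Exec (readWhile c p) v s (t + 1 + t') v'' s'' := by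
  refine Prog.Run.loop_true (by simp only [Store.toStacks, hs, List.head?_cons]; exact hx) ?_ h₂
  rw [Store.update_buf]
  simp only [Store.toStacks, hs, List.head?_cons]
  exact h₁

/-- Read zeros, and count them in the pile `a`. -/
def readZeros : Prog Stack.Sym Reg := readWhile (fun x => x.1 && !x.2) (mark .a)

/-- The symbol after the zeros is consumed too and stays in the register. Its first bit tells
whether the run was ended by a `1` or by the marker of the block. -/
theorem exec_readZeros {m v s x l} (hs : s.buf = List.replicate m (true, false) ++ x :: l)
    (hx : (x.1 && !x.2) = false) :
    Exec readZeros v s (2 * m + 1) (x, v.2) { s with buf := l, a := s.a + m } := by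
  induction m generalizing v s with
  | zero => exact exec_readWhile_false hs hx
  | succ m ih =>
    refine (exec_readWhile_true (x := (true, false)) (by simpa [List.replicate_succ] using hs) rfl
      (exec_mark _ _ _) (ih rfl)).congr ?_ (by omega)
    simp [Store.set, Store.get]; omega

/-- Read letters, and write them. -/
def copyLetters : Prog Stack.Sym Reg := readWhile (fun x => x.1) (emit fun v => some v.1.2)

theorem exec_copyLetters {w : List Bool} {v : Reg} {s i l}
    (hs : s.buf = w.map (fun b => (true, b)) ++ (false, i) :: l) :
    Exec copyLetters v s (2 * w.length + 1) ((false, i), v.2)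
      { s with buf := l, out := w.reverse.map some ++ s.out } := by
  induction w generalizing v s with
  | nil => exact exec_readWhile_false hs rfl
  | cons b w ih =>
    refine (exec_readWhile_true (x := (true, b)) (by simpa using hs) rfl (exec_emit _ _ _)
      (ih rfl)).congr ?_ ?_
    · simp
    · simp only [List.length_cons]; omega

/-- Divide the predecessor of the pile `a` by the sum of the piles `n` and `t`. The quotient goes to
`c`, and the successor of the remainder to `t`. -/
def divide : Prog Stack.Sym Reg :=
  forPile .a <| ifPile .n (mark .t) <| .seq (forPile .t (mark .n)) <| .seq (mark .c) <|
    ifPile .n (mark .t) .skip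

/-- Invariants: the piles `n` and `t` sum to the divisor, and `t + n * c` grows by one for each mark
of `a`. When the pile `n` is exhausted, `t` is full; it is emptied and `c` increases, but `t`
restarts at `1`. Thus `t` ends between `1` and `n`, and is the name of a state. -/
theorem exec_divide_aux (v : Reg) (s : Store) (n : ℕ) (hn : 0 < n) (hs : s.n + s.t = n)
    (hpos : 1 ≤ s.t + s.a) :
    ∃ t c, 1 ≤ t ∧ t ≤ n ∧ t + n * c = s.t + s.a + n * s.c ∧
      Exec divide v s (s.a * (2 * n + 7) + 1) v { s with a := 0, n := n - t, t := t, c := c } := by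
  obtain ⟨m, hm⟩ : ∃ m, s.a = m := ⟨_, rfl⟩
  induction m generalizing s with
  | zero =>
    refine ⟨s.t, s.c, by omega, by omega, by omega, ?_⟩
    apply Exec.congr
    · exact exec_forPile_zero (show s.get .a = 0 from hm)
    · cases s
      simp only [Store.mk.injEq] at *
      simp only [true_and, and_true]
      exact ⟨by omega, hm⟩
    · omega
  | succ m ih =>
    have hm' : s.get .a = m + 1 := hm
    rcases h0 : s.n with _ | k
    · obtain ⟨t, c, h₁, h₂, h₃, h₄⟩ := ih { s with a := m, n := n - 1, t := 1, c := s.c + 1 }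
        (by simp only; omega) (by simp only; omega) rfl
      refine ⟨t, c, h₁, h₂, ?_, ?_⟩
      · rw [h₃]; simp only [hm]; rw [← hs, h0]; ring
      · have hbody : Exec (ifPile .n (mark .t) <| .seq (forPile .t (mark .n)) <|
            .seq (mark .c) <| ifPile .n (mark .t) .skip) v (s.set .a m) (2 * n + 5) v
            { s with a := m, n := n - 1, t := 1, c := s.c + 1 } := by
          apply Exec.congr
          · exact exec_ifPile_zero (show (s.set .a m).get .n = 0 from h0)
              (Exec.seq (exec_move (by decide) _ _) (Exec.seq (exec_mark _ _ _)
                (exec_ifPile_succ (m := n - 1) (by simp only [Store.set, Store.get]; omega)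
                  (exec_mark _ _ _))))
          · simp [Store.set, Store.get]
          · simp only [Store.set, Store.get]; omega
        apply Exec.congr
        · exact exec_forPile_succ hm' hbody h₄
        · rfl
        · simp only [hm, Nat.succ_mul]; omega
    · obtain ⟨t, c, h₁, h₂, h₃, h₄⟩ := ih { s with a := m, n := k, t := s.t + 1 }
        (by simp only; omega) (by simp only; omega) rfl
      refine ⟨t, c, h₁, h₂, ?_, ?_⟩
      · rw [h₃]; simp only [hm]; ring
      · apply Exec.congr
        · exact exec_forPile_succ hm'
            (exec_ifPile_succ (show (s.set .a m).get .n = k + 1 from h0) (exec_mark _ _ _)) h₄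
        · rfl
        · simp only [hm, Nat.succ_mul]; omega

theorem exec_divide {v : Reg} {s : Store} {a : ℕ} (hn : 0 < s.n) (ht : s.t = 0)
    (ha : s.a = a + 1) :
    Exec divide v s ((a + 1) * (2 * s.n + 7) + 1) v { s with
      a := 0, n := s.n - (a % s.n + 1), t := a % s.n + 1, c := s.c + a / s.n } := by
  obtain ⟨t, c, h₁, h₂, h₃, h₄⟩ := exec_divide_aux v s s.n hn (by omega) (by omega)
  obtain ⟨r, rfl⟩ : ∃ r, t = r + 1 := ⟨t - 1, by omega⟩
  have hc : s.c ≤ c := by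
    by_contra hlt
    have := Nat.mul_le_mul_left s.n (show c + 1 ≤ s.c by omega)
    rw [Nat.mul_succ] at this
    omega
  have hr : a = r + s.n * (c - s.c) := by
    rw [Nat.mul_sub]
    have := Nat.mul_le_mul_left s.n hc
    omega
  have hmod : a % s.n = r := by
    rw [hr, Nat.add_mul_mod_self_left, Nat.mod_eq_of_lt (by omega)]
  have hdiv : s.c + a / s.n = c := by
    rw [hr, Nat.add_mul_div_left _ _ hn, Nat.div_eq_of_lt (by omega)]
    omega
  rw [hmod, hdiv, ← ha]
  exact h₄

/-- Write `reflect p c` zeros, where `p` and `c` are the values of the piles of this name. -/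
def emitReflect : Prog Stack.Sym Reg :=
  .seq (.load fun v => (v.1, false)) <|
  .seq (forPile .c (ifPile .p (mark .d) (.seq emitZero (.load fun v => (v.1, true))))) <|
  .seq (.ite (fun v => v.2) (forPile .d (.seq emitZero (mark .p)))
    (forPile .p (.seq emitZero (mark .d)))) <|
  forPile .d (mark .p)

/-- Marks of `c` and `p` are cancelled in pairs, with a record in `d`. The excess of `c` over `p` is
written at once as zeros, and the flag remembers that there was one. -/
theorem exec_cancel (v : Reg) (s : Store) :
    Exec (forPile .c (ifPile .p (mark .d) (.seq emitZero (.load fun v => (v.1, true))))) v s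
      (4 * s.c + 1) (v.1, v.2 || decide (s.p < s.c))
      { s with c := 0, p := s.p - s.c, d := s.d + min s.c s.p,
               out := List.replicate (s.c - s.p) (some false) ++ s.out } := by
  obtain ⟨m, hm⟩ : ∃ m, s.c = m := ⟨_, rfl⟩
  induction m generalizing s v with
  | zero =>
    have h := exec_forPile_zero (i := .c) (v := v) (s := s) hm
      (p := ifPile .p (mark .d) (.seq emitZero (.load fun v => (v.1, true))))
    obtain ⟨⟩ := s
    subst hm
    simpa using h
  | succ m ih =>
    rcases h0 : s.p with _ | k
    · have h := exec_forPile_succ (i := .c) (v := v) (s := s) hm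
        (exec_ifPile_zero (i := .p) h0 ((exec_emit _ _ _).seq (exec_load _ _ _)))
        (ih _ _ rfl) (p := ifPile .p (mark .d) (.seq emitZero (.load fun v => (v.1, true))))
      convert h using 1
      · simp [hm, Store.set]; omega
      · simp [hm, Store.set]
      · simp [hm, Store.set, h0, List.replicate_succ']
    · apply Exec.congr_register
      · exact exec_forPile_succ (show s.get .c = m + 1 from hm)
          (exec_ifPile_succ (show (s.set .c m).get .p = k + 1 from h0) (exec_mark _ _ _))
          (ih _ _ rfl)
      · exact Prod.ext rfl (congrArg (v.2 || ·) (decide_eq_decide.2 (by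
          simp [hm, Store.set])))
      · simp [hm, Store.set, Store.get]; omega
      · simp [hm, Store.set, Store.get]; omega

/-- If `c` exceeds `p`, the zeros already written are completed by one for each of the `p` marks of
`d`, to `c` in total. Otherwise the `p - c` marks left in `p` are written. Both cases end with all
marks back in `p`. -/
theorem exec_emitReflect {v : Reg} {s : Store} (hd : s.d = 0) :
    ∃ b, Exec emitReflect v s (4 * s.c + 5 * s.p + 6) (v.1, b)
      { s with c := 0, out := List.replicate (reflect s.p s.c) (some false) ++ s.out } := by
  by_cases hlt : s.p < s.c
  · refine ⟨true, ?_⟩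
    apply Exec.congr
    · have hc := exec_cancel (v.1, false) s
      rw [show ((v.1, false).2 || decide (s.p < s.c)) = true by simp [hlt]] at hc
      exact Exec.seq (exec_load _ _ _) (Exec.seq hc (Exec.seq
        (exec_ite_true rfl (exec_emitZerosMove (by decide) _ _)) (exec_move (by decide) _ _)))
    · have h1 : min s.c s.p = s.p := by omega
      have h2 : s.p - s.c = 0 := by omega
      have h3 : reflect s.p s.c = s.p + (s.c - s.p) := by unfold reflect; split_ifs <;> omega
      simp [Store.set, Store.get, hd, h1, h2, h3, ← List.append_assoc]
    · simp [Store.set, Store.get, hd]; omega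
  · refine ⟨false, ?_⟩
    apply Exec.congr
    · have hc := exec_cancel (v.1, false) s
      rw [show ((v.1, false).2 || decide (s.p < s.c)) = false by simp; omega] at hc
      exact Exec.seq (exec_load _ _ _) (Exec.seq hc (Exec.seq
        (exec_ite_false rfl (exec_emitZerosMove (by decide) _ _)) (exec_move (by decide) _ _)))
    · have h1 : min s.c s.p = s.c := by omega
      have h2 : s.c - s.p = 0 := by omega
      have h3 : reflect s.p s.c = s.p - s.c := by unfold reflect; split_ifs <;> omega
      simp [Store.set, Store.get, hd, h1, h2, h3]; omega
    · simp [Store.set, Store.get, hd]; omega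

/-- Empty the pile `u`, and write its value in binary. -/
def emitBinary : Prog Stack.Sym Reg :=
  forPile .u <|
  .seq (.load fun v => (v.1, true)) <|
  .seq (forPile .u (.ite (fun v => v.2) (.seq (.load fun v => (v.1, false)) (mark .x))
    (.load fun v => (v.1, true)))) <|
  .seq (emit fun v => some v.2) <|
  forPile .x (mark .u)

/-- The flag acts as one further mark waiting for a partner, and each completed pair gives a mark of
`x`. In `emitBinary` it starts as `true` to replace the mark removed by the outer loop. -/
theorem exec_halve (v : Reg) (s : Store) :
    Exec (forPile .u (.ite (fun v => v.2) (.seq (.load fun v => (v.1, false)) (mark .x))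
      (.load fun v => (v.1, true)))) v s (4 * s.u + 1)
      (v.1, (s.u + v.2.toNat).bodd) { s with u := 0, x := s.x + (s.u + v.2.toNat) / 2 } := by
  obtain ⟨m, hm⟩ : ∃ m, s.u = m := ⟨_, rfl⟩
  induction m generalizing s v with
  | zero =>
    have h := exec_forPile_zero (i := .u) (v := v) (s := s) hm
      (p := .ite (fun v => v.2) (.seq (.load fun v => (v.1, false)) (mark .x))
        (.load fun v => (v.1, true)))
    obtain ⟨y, b⟩ := v
    obtain ⟨⟩ := s
    subst hm
    cases b <;> simpa using h
  | succ m ih =>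
    obtain ⟨y, b⟩ := v
    have hm' : s.get .u = m + 1 := hm
    cases b
    · apply Exec.congr_register
      · exact exec_forPile_succ hm' (exec_ite_false rfl (exec_load _ _ _)) (ih _ _ rfl)
      · simp [hm, Store.set]
      · simp [hm, Store.set]
      · simp [hm, Store.set]; omega
    · apply Exec.congr_register
      · exact exec_forPile_succ hm'
          (exec_ite_true rfl (Exec.seq (exec_load _ _ _) (exec_mark _ _ _))) (ih _ _ rfl)
      · simp [hm, Store.set, Store.get]
      · simp [hm, Store.set, Store.get]; omega
      · simp [hm, Store.set, Store.get]; omega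

theorem bits_succ (m : ℕ) : (m + 1).bits = (m + 1).bodd :: ((m + 1) / 2).bits := by
  rw [← Nat.div2_val]
  conv_lhs => rw [← Nat.bit_bodd_div2 (m + 1)]
  rw [Nat.bits_append_bit]
  intro h
  have h2 := Nat.bodd_add_div2 (m + 1)
  cases hb : (m + 1).bodd
  · rw [h, hb] at h2
    simp at h2
  · rfl

/-- Digits are pushed from the least significant one on, so the most significant one ends on top.
The crude bound, with as many rounds as the value, suffices because the values are state numbers. -/
theorem exec_emitBinary {v : Reg} {s : Store} (hx : s.x = 0) :
    ∃ b, Exec emitBinary v s (s.u * (5 * s.u + 6) + 1) (v.1, b)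
      { s with u := 0, out := s.u.bits.reverse.map some ++ s.out } := by
  obtain ⟨m, hm⟩ : ∃ m, s.u = m := ⟨_, rfl⟩
  induction m using Nat.strong_induction_on generalizing s v with
  | _ m ih =>
    rcases m with _ | m
    · refine ⟨v.2, ?_⟩
      apply Exec.congr
      · exact exec_forPile_zero (show s.get .u = 0 from hm)
      · obtain ⟨⟩ := s
        subst hm
        simp
      · omega
    · obtain ⟨b, h⟩ := ih ((m + 1) / 2) (by omega) (v := (v.1, (m + 1).bodd))
        (s := { s with u := (m + 1) / 2, out := some (m + 1).bodd :: s.out }) hx rfl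
      refine ⟨b, ?_⟩
      have hbody : Exec (.seq (.load fun v => (v.1, true)) <| .seq (forPile .u
          (.ite (fun v => v.2) (.seq (.load fun v => (v.1, false)) (mark .x))
            (.load fun v => (v.1, true)))) <| .seq (emit fun v => some v.2) <|
          forPile .x (mark .u)) v (s.set .u m) (5 * m + 5) (v.1, (m + 1).bodd)
          { s with u := (m + 1) / 2, out := some (m + 1).bodd :: s.out } := by
        apply Exec.congr
        · exact Exec.seq (exec_load _ _ _)
            (Exec.seq (exec_halve _ _) (Exec.seq (exec_emit _ _ _) (exec_move (by decide) _ _)))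
        · simp [Store.set, Store.get, hx]
        · simp only [Store.set, Store.get, hx, Bool.toNat_true, Nat.zero_add]; omega
      apply Exec.congr
      · exact exec_forPile_succ (show s.get .u = m + 1 from hm) hbody h
      · have hbits := bits_succ m
        simp [hm, hbits]
      · simp only [hm]
        have h2 : (m + 1) / 2 ≤ m := by omega
        have := Nat.mul_le_mul h2 (show 5 * ((m + 1) / 2) + 6 ≤ 5 * (m + 1) + 6 by omega)
        have := Nat.succ_mul m (5 * (m + 1) + 6)
        simp only [Nat.succ_eq_add_one] at this
        omega

/-- Read the code of a transition, write its output, and put the number of its target state into the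
pile `t`. -/
def readCode : Prog Stack.Sym Reg :=
  .seq (mark .a) <| .seq readZeros <| .seq divide <|
  .ite (fun v => v.1.1) (.seq emitReflect <| .seq (emit fun v => some v.1.2) copyLetters)
    (forPile .c emitZero)

theorem execTo_readCode (v : Reg) (u : List Bool) (i : Bool) (l : List (Bool × Bool))
    (out : List (Option Bool)) {n L : ℕ} (q : ℕ) (hn : 0 < n) (hL : n ≤ L)
    (hu : u.length + 1 ≤ L) :
    ExecTo readCode v
      { buf := u.map (fun b => (true, b)) ++ (false, i) :: l, out := out, n := n, q := q,
        p := longRun n }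
      (40 * (L * L))
      { buf := l, out := (decodeOutput n u).map some ++ out, n := n - (decodeTarget n u + 1),
        t := decodeTarget n u + 1, q := q, p := longRun n } := by
  obtain ⟨a, r, rfl⟩ : ∃ a r, u = joinRun a r := ⟨_, _, (joinRun_splitRun u).symm⟩
  simp only [decodeOutput, decodeTarget, splitRun_joinRun]
  have hdiv : a / n ≤ a := Nat.div_le_self a n
  have hnn : n * n ≤ L * L := Nat.mul_le_mul hL hL
  have hLL : L ≤ L * L := Nat.le_mul_of_pos_left L (by omega)
  -- The reflection handles up to `2 * n * n` marks, which is within the quadratic bound.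
  have hrun : longRun n = 2 * (n * n) := Nat.mul_assoc _ _ _
  have htime : a + 1 ≤ L → (a + 1) * (2 * n + 7) ≤ 2 * (L * L) + 7 * L := fun h => by
    calc (a + 1) * (2 * n + 7) ≤ L * (2 * L + 7) := Nat.mul_le_mul h (by omega)
      _ = 2 * (L * L) + 7 * L := by ring
  cases r with
  | none =>
    rw [length_joinRun_none] at hu
    have htime := htime hu
    simp only [joinRun, List.map_replicate, flipRun, List.reverse_replicate]
    refine ⟨((false, i), v.2), ?_⟩
    apply Exec.congr
    · refine Exec.seq (exec_mark _ _ _) (Exec.seq (exec_readZeros (m := a) rfl rfl)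
        (Exec.seq (exec_divide (a := a) hn rfl ?_)
          (exec_ite_false rfl (exec_emitZeros _ _ _))))
      simp [Store.set, Store.get, Nat.add_comm]
    · simp [Store.set, Store.get]
    · simp only [Store.set, Store.get]; omega
  | some w =>
    rw [length_joinRun_some] at hu
    have htime := htime (by omega)
    simp only [joinRun, List.map_append, List.map_replicate, List.map_cons, flipRun,
      List.append_assoc, List.cons_append]
    have hw : ∀ (v : Reg) (b : Bool) (s : Store), v.1 = (true, true) →
        s.buf = w.map (fun b => (true, b)) ++ (false, i) :: l →
        Exec (.seq (emit fun v => some v.1.2) copyLetters) (v.1, b) s (2 * w.length + 2)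
          ((false, i), b)
          { s with buf := l, out := w.reverse.map some ++ some true :: s.out } := by
      intro v b s hv hs
      apply Exec.congr
      · exact Exec.seq (exec_emit _ _ _) (exec_copyLetters hs)
      · simp [hv]
      · omega
    have hex := exec_emitReflect (v := ((true, true), v.2))
      (s := { buf := w.map (fun b => (true, b)) ++ (false, i) :: l, out := out,
              n := n - (a % n + 1), t := a % n + 1, c := a / n, q := q, p := longRun n }) rfl
    obtain ⟨b, hb⟩ := hex
    refine ⟨((false, i), b), ?_⟩
    apply Exec.congr
    · refine Exec.seq (exec_mark _ _ _) (Exec.seq (exec_readZeros (m := a) rfl rfl)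
        (Exec.seq_of_eq (exec_divide (a := a) hn rfl ?_) ?_ (exec_ite_true rfl (Exec.seq hb
          (hw ((true, true), v.2) b _ rfl rfl)))))
      · simp [Store.set, Store.get, Nat.add_comm]
      · simp [Store.set, Store.get]
    · simp
    · simp only [Store.set, Store.get]; omega

/-- The transition with source `q` and input letter `i` that has the code `u`. -/
def transitionWord (n q : ℕ) (i : Bool) (u : List Bool) : List (Option Bool) :=
  (Nat.bits (q + 1)).reverse.map some ++ [none, some i, none] ++
    (Nat.bits (decodeTarget n u + 1)).reverse.map some ++ [none] ++
    (decodeOutput n u).map some ++ [none]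

/-- Read the code of a transition with the input letter `i`, and write the transition. -/
def writeTransition (i : Bool) : Prog Stack.Sym Reg :=
  .seq (emit fun _ => none) <| .seq readCode <| .seq (emit fun _ => none) <|
  .seq (forPile .t (.seq (mark .n) (mark .u))) <| .seq emitBinary <| .seq (emit fun _ => none) <|
  .seq (emit fun _ => some i) <| .seq (emit fun _ => none) <|
  .seq (forPile .q (.seq (mark .u) (mark .r))) <| .seq (forPile .r (mark .q)) <|
  .seq (mark .u) emitBinary

/-- The output is a stack, so a transition is written from its end to its beginning; this is why the
codes are read backwards. Moving `t` to both `n` and `u` repairs the divisor, from which the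
division took exactly `t` marks. The source has the index `q` and the name `q + 1`, whence the
additional mark of `u`. -/
theorem execTo_writeTransition (v : Reg) (u : List Bool) (i : Bool) (l : List (Bool × Bool))
    (out : List (Option Bool)) {n L q : ℕ} (hn : 0 < n) (hL : n ≤ L) (hu : u.length + 1 ≤ L)
    (hq : q + 1 ≤ L) :
    ExecTo (writeTransition i) v
      { buf := u.map (fun b => (true, b)) ++ (false, i) :: l, out := out, n := n, q := q,
        p := longRun n }
      (80 * (L * L))
      { buf := l, out := transitionWord n q i u ++ out, n := n, q := q, p := longRun n } := by
  obtain ⟨v₁, h₁⟩ := execTo_readCode v u i l (none :: out) q hn hL hu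
  have ht : decodeTarget n u + 1 ≤ n := Nat.mod_lt _ hn
  have hbinary : ∀ m, m ≤ L → m * (5 * m + 6) ≤ 5 * (L * L) + 6 * L := fun m hm => by
    calc m * (5 * m + 6) ≤ L * (5 * L + 6) := Nat.mul_le_mul hm (by omega)
      _ = 5 * (L * L) + 6 * L := by ring
  have hb₁ := hbinary _ (ht.trans hL)
  have hb₂ := hbinary _ hq
  have hLL : L ≤ L * L := Nat.le_mul_of_pos_left L (by omega)
  obtain ⟨b₂, h₂⟩ := exec_emitBinary (v := v₁)
    (s := { buf := l, out := none :: ((decodeOutput n u).map some ++ none :: out), n := n,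
            u := decodeTarget n u + 1, q := q, p := longRun n }) rfl
  obtain ⟨b₃, h₃⟩ := exec_emitBinary (v := (v₁.1, b₂))
    (s := { buf := l, out := none :: some i :: none ::
              ((Nat.bits (decodeTarget n u + 1)).reverse.map some ++
                none :: ((decodeOutput n u).map some ++ none :: out)),
            n := n, u := q + 1, q := q, p := longRun n }) rfl
  refine ⟨(v₁.1, b₃), ?_⟩
  apply Exec.congr
  · refine Exec.seq (exec_emit _ _ _) (Exec.seq h₁ (Exec.seq (exec_emit _ _ _) (Exec.seq_of_eq
      (exec_moveTwo (by decide) (by decide) (by decide) _ _) ?_ (Exec.seq h₂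
      (Exec.seq (exec_emit _ _ _) (Exec.seq (exec_emit _ _ _) (Exec.seq (exec_emit _ _ _)
      (Exec.seq (exec_moveTwo (by decide) (by decide) (by decide) _ _) (Exec.seq
      (exec_move (by decide) _ _) (Exec.seq_of_eq (exec_mark _ _ _) ?_ h₃))))))))))
    · simp [Store.set, Store.get]
      omega
    · simp [Store.set, Store.get]
  · simp [transitionWord]
  · simp only [Store.set, Store.get]; omega

/-- The symbols of the two blocks of a state. -/
def rowSymbols (r : List Bool × List Bool) : List (Bool × Bool) :=
  (false, false) :: r.1.reverse.map (fun b => (true, b)) ++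
    (false, true) :: r.2.reverse.map (fun b => (true, b))

theorem flatMap_rowSymbols (r : List Bool × List Bool) :
    (rowSymbols r).flatMap (fun x => [x.1, x.2]) = rowBits r := by
  simp [rowSymbols, rowBits, blockBits, letterBits, List.flatMap_map, - List.map_reverse]

/-- Letters have first bit `1`, and the marker of the second block is `(false, true)`. Counting
`(false, false)` therefore counts the states. -/
theorem count_rowSymbols (r : List Bool × List Bool) :
    (rowSymbols r).count (false, false) = 1 := by
  have h : ∀ u : List Bool, (u.map fun b => (true, b)).count (false, false) = 0 := fun u =>
    List.count_eq_zero.2 (by simp)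
  simp [rowSymbols, h, - List.map_reverse]

/-- The transitions with the codes `r.1` and `r.2`. -/
def rowWord (n : ℕ) (r : (List Bool × List Bool) × ℕ) : List (Option Bool) :=
  transitionWord n r.2 false r.1.1 ++ transitionWord n r.2 true r.1.2

/-- Read the codes of all transitions, and write the transitions. -/
def writeTransitions : Prog Stack.Sym Reg :=
  forPile .q (.seq (writeTransition true) (writeTransition false))

/-- The rows are treated from the last to the first, hence the induction from the end of the list.
The loop removes a mark of `q` before its body, so that `q` is the index of the current row. -/
theorem execTo_writeTransitions (v : Reg) (rs : List (List Bool × List Bool))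
    (out : List (Option Bool)) {n L : ℕ} (hn : 0 < n) (hL : n ≤ L) (hrs : rs.length ≤ L)
    (hu : ∀ r ∈ rs, r.1.length + 1 ≤ L ∧ r.2.length + 1 ≤ L) :
    ExecTo writeTransitions v
      { buf := (rs.flatMap rowSymbols).reverse, out := out, n := n, q := rs.length,
        p := longRun n }
      (rs.length * (160 * (L * L) + 1) + 1)
      { out := rs.zipIdx.flatMap (rowWord n) ++ out, n := n, p := longRun n } := by
  induction rs using List.reverseRecOn generalizing v out with
  | nil => exact ⟨v, (exec_forPile_zero rfl).congr rfl (by simp)⟩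
  | append_singleton rs r ih =>
    have hr := hu r (by simp)
    have hlen : rs.length + 1 ≤ L := by simpa using hrs
    have hfirst : ExecTo (writeTransition true) v
        (Store.set { buf := ((rs ++ [r]).flatMap rowSymbols).reverse, out := out, n := n,
                     q := (rs ++ [r]).length, p := longRun n } .q rs.length)
        (80 * (L * L))
        { buf := r.1.map (fun b => (true, b)) ++ (false, false) :: (rs.flatMap rowSymbols).reverse,
          out := transitionWord n rs.length true r.2 ++ out, n := n, q := rs.length,
          p := longRun n } := by
      convert execTo_writeTransition v r.2 true _ out hn hL hr.2 hlen using 1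
      simp [Store.set, rowSymbols]
    apply ExecTo.congr
    · exact execTo_forPile_succ (i := .q) (m := rs.length) (by simp [Store.get])
        (ExecTo.seq hfirst fun v' => execTo_writeTransition _ _ _ _ _ hn hL hr.1 hlen)
        fun v' => ih v' _ (by omega) fun r hr => hu r (by simp [hr])
    · simp [rowWord, List.zipIdx_append]
    · simp only [List.length_append, List.length_cons, List.length_nil, Nat.zero_add,
        Nat.succ_mul]
      omega

/-- Read the second bit of a symbol, put the symbol into the buffer, and count it if it starts the
row of a state. -/
def readSymbol : Prog Stack.Sym Reg :=
  .popIte .inp (fun v o => ((v.1.1, o.getD false), v.2)) (fun v o => !v.1.1 && !o.getD false)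
    (.seq (mark .n) <| .seq (mark .q) <| .seq (mark .a) <| .push .buf fun v => v.1)
    (.push .buf fun v => v.1)

/-- Read the input into the buffer, and count the states of the encoded transducer. -/
def readInput : Prog Stack.Sym Reg :=
  .loop .inp (fun v o => ((o.getD false, v.1.2), v.2)) (fun _ o => o.isSome) readSymbol

theorem exec_push_buf (f v s) :
    Exec (.push .buf f) v s 1 v { s with buf := f v :: s.buf } := by
  have h := Prog.Run.push .buf f v s.toStacks
  rw [Store.update_buf] at h
  exact h

theorem exec_readSymbol (i b c d : Bool) {s : Store} {l : List Bool} (hs : s.inp = b :: l) :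
    Exec readSymbol ((i, c), d) s 5 ((i, b), d)
      { s with inp := l, buf := (i, b) :: s.buf, n := s.n + [(i, b)].count (false, false),
               q := s.q + [(i, b)].count (false, false),
               a := s.a + [(i, b)].count (false, false) } := by
  have hupdate : Function.update s.toStacks .inp (s.toStacks .inp).tail =
      { s with inp := l }.toStacks := by
    rw [Store.update_inp]
    simp only [Store.toStacks, hs, List.tail_cons]
  have hhead : (s.toStacks .inp).head? = some b := by
    simp only [Store.toStacks, hs, List.head?_cons]
  cases hc : (!i && !b)
  · refine Prog.Run.popIte_false (by rw [hhead]; exact hc) ?_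
    rw [hupdate, hhead]
    refine Exec.congr (exec_push_buf (fun v => v.1) _ _) ?_ (by omega)
    have hne : ((i, b) == (false, false)) = false := by cases i <;> cases b <;> simp_all
    simp [List.count_cons, hne]
  · obtain ⟨rfl, rfl⟩ : i = false ∧ b = false := by simpa using hc
    refine Prog.Run.popIte_true (by rw [hhead]; exact hc) ?_
    rw [hupdate, hhead]
    exact Exec.seq (exec_mark _ _ _) (Exec.seq (exec_mark _ _ _) (Exec.seq (exec_mark _ _ _)
      (exec_push_buf (fun v => v.1) _ _)))

theorem execTo_readInput (v : Reg) (xs : List (Bool × Bool)) (s : Store)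
    (hs : s.inp = xs.flatMap fun x => [x.1, x.2]) :
    ExecTo readInput v s (6 * xs.length + 1)
      { s with inp := [], buf := xs.reverse ++ s.buf, n := s.n + xs.count (false, false),
               q := s.q + xs.count (false, false), a := s.a + xs.count (false, false) } := by
  induction xs generalizing v s with
  | nil =>
    have h := Prog.Run.loop_false (k := Stack.inp) (v := v) (S := s.toStacks) (p := readSymbol)
      (f := fun (v : Reg) o => ((o.getD false, v.1.2), v.2)) (c := fun _ o => o.isSome)
      (by simp [Store.toStacks, hs])
    rw [Store.update_inp] at h
    refine ⟨_, Exec.congr h ?_ le_rfl⟩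
    simp [Store.toStacks, hs]
  | cons x xs ih =>
    obtain ⟨i, b⟩ := x
    have hs' : s.inp = i :: b :: xs.flatMap fun x => [x.1, x.2] := by simpa using hs
    have hupdate : Function.update s.toStacks .inp (s.toStacks .inp).tail =
        Store.toStacks { s with inp := b :: xs.flatMap fun x => [x.1, x.2] } := by
      rw [Store.update_inp]
      simp only [Store.toStacks, hs', List.tail_cons]
    have hhead : (s.toStacks .inp).head? = some i := by
      simp only [Store.toStacks, hs', List.head?_cons]
    obtain ⟨v', h⟩ := ih ((i, b), v.2)
      { s with inp := xs.flatMap fun x => [x.1, x.2], buf := (i, b) :: s.buf,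
               n := s.n + [(i, b)].count (false, false),
               q := s.q + [(i, b)].count (false, false),
               a := s.a + [(i, b)].count (false, false) } rfl
    have hloop : Exec readInput v s (5 + 1 + (6 * xs.length + 1)) v' _ :=
      Prog.Run.loop_true (by rw [hhead]; rfl)
        (by rw [hupdate, hhead]; exact exec_readSymbol i b v.1.2 v.2 rfl) h
    refine ⟨v', hloop.congr ?_ ?_⟩
    · simp [List.count_cons, Nat.add_assoc, Nat.add_comm]
    · simp only [List.length_cons]; omega

/-- Put `longRun n` marks into the pile `p`, if the piles `a` and `q` have `n` marks. -/
def countRun : Prog Stack.Sym Reg :=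
  forPile .a <| .seq (forPile .q (.seq (mark .r) (.seq (mark .p) (mark .p)))) <|
    forPile .r (mark .q)

theorem exec_countRow (v : Reg) (s : Store) :
    Exec (forPile .q (.seq (mark .r) (.seq (mark .p) (mark .p)))) v s (4 * s.q + 1) v
      { s with q := 0, r := s.r + s.q, p := s.p + 2 * s.q } := by
  obtain ⟨m, hm⟩ : ∃ m, s.q = m := ⟨_, rfl⟩
  induction m generalizing s with
  | zero =>
    apply Exec.congr
    · exact exec_forPile_zero (show s.get .q = 0 from hm)
    · obtain ⟨⟩ := s
      subst hm
      simp
    · omega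
  | succ m ih =>
    apply Exec.congr
    · exact exec_forPile_succ (show s.get .q = m + 1 from hm) (Exec.seq (exec_mark _ _ _)
        (Exec.seq (exec_mark _ _ _) (exec_mark _ _ _))) (ih _ rfl)
    · simp [Store.set, Store.get, hm]; omega
    · simp [Store.set, Store.get, hm]; omega

theorem exec_countRun (v : Reg) (s : Store) (hr : s.r = 0) :
    Exec countRun v s (s.a * (6 * s.q + 3) + 1) v
      { s with a := 0, p := s.p + 2 * s.a * s.q } := by
  obtain ⟨m, hm⟩ : ∃ m, s.a = m := ⟨_, rfl⟩
  induction m generalizing s with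
  | zero =>
    apply Exec.congr
    · exact exec_forPile_zero (show s.get .a = 0 from hm)
    · obtain ⟨⟩ := s
      subst hm
      simp
    · omega
  | succ m ih =>
    have hbody : Exec (.seq (forPile .q (.seq (mark .r) (.seq (mark .p) (mark .p)))) <|
        forPile .r (mark .q)) v (s.set .a m) (6 * s.q + 2) v
        { s with a := m, p := s.p + 2 * s.q } := by
      apply Exec.congr
      · exact Exec.seq (exec_countRow _ _) (exec_move (by decide) _ _)
      · simp [Store.set, Store.get, hr]
      · simp only [Store.set, Store.get, hr]; omega
    apply Exec.congr
    · exact exec_forPile_succ (show s.get .a = m + 1 from hm) hbody (ih _ hr rfl)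
    · simp only [hm, Store.mk.injEq, true_and, and_true]
      ring
    · simp only [hm, Nat.succ_mul]
      omega

/-- A program which turns the code of a transducer into the list of its transitions. -/
def decoder : Prog Stack.Sym Reg :=
  .seq readInput <| .seq countRun <| .seq writeTransitions <| .seq (forPile .n .skip)
    (forPile .p .skip)

theorem count_flatMap_rowSymbols (rs : List (List Bool × List Bool)) :
    (rs.flatMap rowSymbols).count (false, false) = rs.length := by
  induction rs with
  | nil => rfl
  | cons r rs ih => simp [List.count_append, count_rowSymbols, ih, Nat.add_comm]

/-- The bound is cubic: there are at most as many rows as bits, each with quadratic work. The piles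
`n` and `p` are cleared at the end because a halting machine must leave only its output. -/
theorem execTo_decoder (v : Reg) (rs : List (List Bool × List Bool)) (hrs : rs ≠ []) :
    ExecTo decoder v { inp := rs.flatMap rowBits }
      (200 * ((rs.flatMap rowBits).length + 1) ^ 3)
      { out := rs.zipIdx.flatMap (rowWord rs.length) } := by
  have hlen : 2 * (rs.flatMap rowSymbols).length = (rs.flatMap rowBits).length := by
    have h : rs.flatMap rowBits = (rs.flatMap rowSymbols).flatMap fun x => [x.1, x.2] := by
      simp only [List.flatMap_assoc, flatMap_rowSymbols]
    rw [h, List.length_flatMap]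
    simp [Nat.mul_comm]
  have hmem : ∀ r ∈ rs, (rowBits r).length ≤ (rs.flatMap rowBits).length := by
    intro r hr
    rw [List.length_flatMap]
    exact List.single_le_sum (by simp) _ (List.mem_map.2 ⟨r, hr, rfl⟩)
  have hn : rs.length ≤ (rs.flatMap rowBits).length := by
    rw [← count_flatMap_rowSymbols rs]
    have := List.count_le_length (a := (false, false)) (l := rs.flatMap rowSymbols)
    omega
  have hpos : 0 < rs.length := List.length_pos_iff.2 hrs
  generalize hL : (rs.flatMap rowBits).length = ℓ at *
  have hread := execTo_readInput v (rs.flatMap rowSymbols) { inp := rs.flatMap rowBits }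
    (by simp only [List.flatMap_assoc, flatMap_rowSymbols])
  simp only [count_flatMap_rowSymbols, Nat.zero_add, List.append_nil] at hread
  have hwrite : ∀ v', ExecTo writeTransitions v'
      { buf := (rs.flatMap rowSymbols).reverse, n := rs.length, q := rs.length,
        p := 0 + 2 * rs.length * rs.length }
      (rs.length * (160 * ((ℓ + 1) * (ℓ + 1)) + 1) + 1)
      { out := rs.zipIdx.flatMap (rowWord rs.length), n := rs.length, p := longRun rs.length } := by
    intro v'
    convert execTo_writeTransitions v' rs [] (n := rs.length) (L := ℓ + 1) hpos (by omega)
      (by omega) ?_ using 1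
    · simp [longRun]
    · simp
    · intro r hr
      have h₁ := hmem r hr
      rw [length_rowBits] at h₁
      omega
  apply ExecTo.congr
  · exact ExecTo.seq hread fun v' => Exec.seqTo (exec_countRun _ _ rfl) (ExecTo.seq (hwrite _)
      fun v' => Exec.to (Exec.seq (exec_clear _ _ _) (exec_clear _ _ _)))
  · simp [Store.set]
  · simp only [Store.set, Store.get, longRun]
    generalize rs.length = n at *
    generalize (rs.flatMap rowSymbols).length = m at *
    -- Writing the length as `n + k` turns the bound into a comparison of polynomials with
    -- nonnegative coefficients.
    obtain ⟨k, rfl⟩ := Nat.exists_eq_add_of_le hn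
    nlinarith [Nat.zero_le (n * n * n), Nat.zero_le (n * n * k), Nat.zero_le (n * k * k),
      Nat.zero_le (k * k * k), Nat.zero_le (n * n), Nat.zero_le (n * k), Nat.zero_le (k * k)]

theorem Transducer.transitionList_eq (T : Transducer) :
    T.transitionList = T.rows.zipIdx.flatMap (rowWord T.rows.length) := by
  have hlen : T.rows.length = T.numStates := by simp [rows]
  have hzip : T.rows.zipIdx = (List.finRange T.numStates).map fun q =>
      ((T.pairCode q false, T.pairCode q true), q.val) :=
    List.ext_getElem (by simp [rows]) (by simp [rows])
  have hword : ∀ q i, T.transition q i = transitionWord T.numStates q i (T.pairCode q i) := by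
    intro q i
    rw [transitionWord, pairCode, decodeTarget_encodePair (T.Δ q i).1.isLt,
      decodeOutput_encodePair (T.Δ q i).1.isLt]
    rfl
  rw [hlen, hzip, List.flatMap_map, transitionList]
  simp only [hword, rowWord]

theorem onlyStack_inp (l : List Bool) :
    Prog.onlyStack (Γ := Stack.Sym) Stack.inp l = Store.toStacks { inp := l } := by
  funext k
  cases k with
  | pile i => cases i <;> rfl
  | _ => rfl

theorem onlyStack_out (l : List (Option Bool)) :
    Prog.onlyStack (Γ := Stack.Sym) Stack.out l = Store.toStacks { out := l } := by
  funext k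
  cases k with
  | pile i => cases i <;> rfl
  | _ => rfl

theorem polyTime_decode : Nonempty (Turing.TM2ComputableInPolyTime
    (fun c : runEncoding.dom => (c : List Bool)) Transducer.transitionList runEncoding.decode) := by
  let _ : Fintype (Stack.Sym Stack.inp) := inferInstanceAs (Fintype Bool)
  refine ⟨Prog.polyTime (k₀ := Stack.inp) (k₁ := Stack.out) decoder ((false, false), false) _ _ _
    (200 * (Polynomial.X + 1) ^ 3) fun c => ?_⟩
  rw [onlyStack_inp, onlyStack_out, Transducer.transitionList_eq]
  have hne : (runEncoding.decode c).rows ≠ [] := by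
    rw [← List.length_pos_iff]
    simpa [Transducer.rows] using (runEncoding.decode c).pos
  have h := execTo_decoder ((false, false), false) (runEncoding.decode c).rows hne
  have hcode : (runEncoding.decode c).rows.flatMap rowBits = c := code_decode_runEncoding c
  rw [hcode] at h
  have heval : (200 * (Polynomial.X + 1) ^ 3 : Polynomial ℕ).eval (c : List Bool).length =
      200 * ((c : List Bool).length + 1) ^ 3 := by simp
  rw [heval]
  exact h

end Decoder

end FSC

theorem corollary2 :
    ∃ S : FSC.Encoding, S.IsPolyTime ∧ ∀ n : ℕ, 1 ≤ n → S.level (n - 1) ⊂ S.level n :=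
  ⟨FSC.runEncoding, ⟨FSC.polyTime_mem_dom, FSC.polyTime_decode⟩,
    fun _ hn => FSC.level_runEncoding_ssubset hn⟩
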